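/- Consider Bell tests with $n$ sites, where site $j$ has an input $s_j\in\{0,1\}$ and an output $m_j\in\{0,1\}$. In a quantum experiment the behaviour is $p(\mathbf m|\mathbf s)=\mathrm{Tr}\big(\rho\bigotimes_{j=1}^n P^{s_j}_{m_j}\big)$, where $\rho$ is a density matrix on a tensor product of $n$ Hilbert spaces of arbitrary dimension and, for each site and input, $\{P^{s_j}_0,P^{s_j}_1\}$ is a POVM on that site's space. The inputs $\mathbf s$ are chosen uniformly at random. A Boolean function is called linear if it is a sum modulo $2$ of some of its variables and a constant. Let $\mathbf x$ be a bit-string of length $|\mathbf x|$. In linear output-input post-selection (LOI) the data $(\mathbf m,\mathbf s)$ are accepted for the value $\mathbf x$ if $s_j=g_j(\mathbf x,\mathbf m^{\setminus j})$ for every $j$, where each $g_j$ is a fixed linear Boolean function of the bits of $\mathbf x$ and of the outputs $\mathbf m^{\setminus j}$ of the other sites. Linear input post-selection (LI) is the case in which every $g_j$ depends on $\mathbf x$ only. For post-selections that accept with positive probability for every $\mathbf x$, the correlator is $p(1|\mathbf x)=\Pr\big(\bigoplus_j m_j=1\,\big|\,\text{data accepted for }\mathbf x\big)$. Let $\mathcal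 Q^{n}_{\mathrm{LI},|\mathbf x|}$ and $\mathcal Q^{n}_{\mathrm{LOI},|\mathbf x|}$ be the sets of all functions $\mathbf x\mapsto p(1|\mathbf x)$ that arise from $n$-site quantum experiments under LI and LOI, and let $v$ be the vertex $p(1|\mathbf x)=\delta^1_{f(\mathbf x)}$ with $f(\mathbf x)=\prod_{j=1}^{|\mathbf x|}x_j$. 1. For every $|\mathbf x|\ge 2$, $v\in\mathcal Q^{n}_{\mathrm{LOI},|\mathbf x|}$ for $n=3(|\mathbf x|-1)$. 2. For every $|\mathbf x|\ge 1$, the least $n$ with $v\in\mathcal Q^{n}_{\mathrm{LI},|\mathbf x|}$ is $2^{|\mathbf x|}-1$. This is also the least number of parties with which non-adaptive measurement-based quantum computation (nMBQC) performs $f$ deterministically, that is, with which, for some pure $n$-partite state, some POVMs and some inputs $s_j$ that are linear Boolean functions of $\mathbf x$, $\bigoplus_j m_j=f(\mathbf x)$ with probability $1$ for every $\mathbf x$. 3. $\mathcal Q^{n}_{\mathrm{LI},|\mathbf x|}\subseteq\mathcal Q^{n}_{\mathrm{LOI},|\mathbf x|}$ for all $n$ and $|\mathbf x|$, and the inclusion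 is strict for every $|\mathbf x|\ge 3$ and $n=3(|\mathbf x|-1)$. In particular, the LOI set can be strictly larger than the LI set for fixed $n$ and $|\mathbf x|$. -/

import Mathlib

open scoped BigOperators ComplexOrder Matrix

noncomputable section

namespace BellTest

/-! ### Tensor products of finitely many Hilbert spaces -/

/-- `H` is the Hilbert-space tensor product of the spaces `E j`: there is a multilinear map
`(v j) ↦ ⨂ v j` with `⟪⨂ v j, ⨂ w j⟫ = ∏ ⟪v j, w j⟫` whose image spans a dense subspace.
This determines the (complete) space `H` up to a unique compatible unitary. -/
structure HilbertTensor {n : ℕ} (E : Fin n → Type) [∀ j, NormedAddCommGroup (E j)]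
    [∀ j, InnerProductSpace ℂ (E j)] (H : Type) [NormedAddCommGroup H]
    [InnerProductSpace ℂ H] where
  /-- the product vector `⨂ v j` -/
  tmul : MultilinearMap ℂ E H
  inner_tmul : ∀ v w : ∀ j, E j, inner ℂ (tmul v) (tmul w) = ∏ j, inner ℂ (v j) (w j)
  dense_span : Dense (Submodule.span ℂ (Set.range tmul) : Set H)

namespace HilbertTensor

variable {n : ℕ} {E : Fin n → Type} [∀ j, NormedAddCommGroup (E j)]
  [∀ j, InnerProductSpace ℂ (E j)] {H : Type} [NormedAddCommGroup H]
  [InnerProductSpace ℂ H]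

/-- The linear map from the algebraic tensor product to the Hilbert tensor product. -/
def ofAlg (T : HilbertTensor E H) : (PiTensorProduct ℂ fun j => E j) →ₗ[ℂ] H :=
  PiTensorProduct.lift T.tmul

/-- The bounded operator `⨂ A j` on the tensor product: the continuous extension of the algebraic
tensor product of the operators `A j`. -/
def tensorOp [CompleteSpace H] (T : HilbertTensor E H) (A : ∀ j, E j →L[ℂ] E j) : H →L[ℂ] H :=
  (T.ofAlg ∘ₗ PiTensorProduct.map fun j => (A j).toLinearMap).extendOfNorm T.ofAlg

theorem denseRange_ofAlg (T : HilbertTensor E H) : DenseRange T.ofAlg := by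
  have h : (Submodule.span ℂ (Set.range T.tmul) : Set H) ⊆ Set.range T.ofAlg := by
    have : Submodule.span ℂ (Set.range T.tmul) ≤ LinearMap.range T.ofAlg := by
      rw [Submodule.span_le]
      rintro _ ⟨v, rfl⟩
      exact ⟨PiTensorProduct.tprod ℂ v, by simp [ofAlg]⟩
    exact this
  exact T.dense_span.mono h

theorem posSemidef_prod_sub {N : ℕ} (B D : Fin n → Matrix (Fin N) (Fin N) ℂ)
    (hB : ∀ j, (B j).PosSemidef) (hBD : ∀ j, (D j - B j).PosSemidef) (S : Finset (Fin n)) :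
    (Matrix.of fun a b => ∏ j ∈ S, B j a b).PosSemidef ∧
      (Matrix.of fun a b => ∏ j ∈ S, D j a b - ∏ j ∈ S, B j a b).PosSemidef := by
  induction S using Finset.induction_on with
  | empty =>
    constructor
    · have h := Matrix.posSemidef_vecMulVec_self_star (fun _ : Fin N => (1 : ℂ))
      convert h using 1
      ext a b
      simp [Matrix.vecMulVec_apply]
    · convert (Matrix.PosSemidef.zero (n := Fin N) (R := ℂ)) using 1
      ext a b
      simp
  | insert i S hi ih =>
    obtain ⟨h1, h2⟩ := ih
    have hD : (D i).PosSemidef := by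
      have := (hBD i).add (hB i)
      simpa using this
    constructor
    · have h := (hB i).hadamard h1
      have e : (Matrix.of fun a b => ∏ j ∈ insert i S, B j a b) =
          B i ⊙ Matrix.of fun a b => ∏ j ∈ S, B j a b := by
        ext a b
        simp [Finset.prod_insert hi]
      rw [e]
      exact h
    · have h := (hD.hadamard h2).add ((hBD i).hadamard h1)
      have e : (Matrix.of fun a b => ∏ j ∈ insert i S, D j a b - ∏ j ∈ insert i S, B j a b) =
          (D i ⊙ Matrix.of fun a b => ∏ j ∈ S, D j a b - ∏ j ∈ S, B j a b) +
            (D i - B i) ⊙ Matrix.of fun a b => ∏ j ∈ S, B j a b := by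
        ext a b
        simp [Finset.prod_insert hi]
        ring
      rw [e]
      exact h

theorem norm_ofAlg_map_le (T : HilbertTensor E H) (A : ∀ j, E j →L[ℂ] E j)
    (z : PiTensorProduct ℂ fun j => E j) :
    ‖T.ofAlg (PiTensorProduct.map (fun j => (A j).toLinearMap) z)‖ ≤
      (∏ j, ‖A j‖) * ‖T.ofAlg z‖ := by
  have hz : z ∈ Submodule.span ℂ (Set.range (PiTensorProduct.tprod ℂ (s := fun j => E j))) := by
    rw [PiTensorProduct.span_tprod_eq_top]; trivial
  obtain ⟨N, c, g, rfl⟩ := Submodule.mem_span_set'.1 hz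
  choose v hv using fun a => (g a).2
  simp only [← hv]
  have key : ∀ w : Fin N → ∀ j, E j,
      ((‖∑ a, c a • T.tmul (w a)‖ ^ 2 : ℝ) : ℂ) =
        star c ⬝ᵥ ((Matrix.of fun a b => ∏ j, Matrix.gram ℂ (fun a => w a j) a b) *ᵥ c) := by
    intro w
    have h1 := Matrix.star_dotProduct_gram_mulVec (𝕜 := ℂ) (fun a => T.tmul (w a)) c c
    have h2 : Matrix.gram ℂ (fun a => T.tmul (w a)) =
        Matrix.of fun a b => ∏ j, Matrix.gram ℂ (fun a => w a j) a b := by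
      ext a b
      simp [T.inner_tmul]
    rw [← h2, h1, inner_self_eq_norm_sq_to_K]
    simp
  have hPS := (posSemidef_prod_sub
    (fun j => Matrix.gram ℂ fun a => A j (v a j))
    (fun j => ((‖A j‖ ^ 2 : ℝ) : ℂ) • Matrix.gram ℂ fun a => v a j)
    (fun j => Matrix.posSemidef_gram ℂ _) (fun j => by
      refine Matrix.PosSemidef.of_dotProduct_mulVec_nonneg ?_ fun x => ?_
      · refine Matrix.IsHermitian.sub ?_ (Matrix.isHermitian_gram ℂ _)
        have := (Matrix.isHermitian_gram ℂ (fun a => v a j))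
        ext a b
        simp only [Matrix.conjTranspose_apply, Matrix.smul_apply, Matrix.gram_apply, smul_eq_mul,
          star_mul', RCLike.star_def, Complex.conj_ofReal, inner_conj_symm]
      · rw [Matrix.sub_mulVec, dotProduct_sub, Matrix.smul_mulVec, dotProduct_smul,
          Matrix.star_dotProduct_gram_mulVec, Matrix.star_dotProduct_gram_mulVec,
          inner_self_eq_norm_sq_to_K, inner_self_eq_norm_sq_to_K]
        have h3 : ∑ i, x i • A j (v i j) = A j (∑ i, x i • v i j) := by simp
        rw [h3]
        have h4 := (A j).le_opNorm (∑ i, x i • v i j)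
        have h5 : ‖A j (∑ i, x i • v i j)‖ ^ 2 ≤ ‖A j‖ ^ 2 * ‖∑ i, x i • v i j‖ ^ 2 := by
          rw [← mul_pow]
          exact pow_le_pow_left₀ (norm_nonneg _) h4 2
        rw [sub_nonneg, smul_eq_mul]
        have h8 := Complex.real_le_real.2 h5
        push_cast at h8 ⊢
        exact h8) Finset.univ).2.dotProduct_mulVec_nonneg c
  have hsplit : (Matrix.of fun a b =>
      ∏ j, (((‖A j‖ ^ 2 : ℝ) : ℂ) • Matrix.gram ℂ fun a => v a j) a b -
        ∏ j, (Matrix.gram ℂ fun a => A j (v a j)) a b) =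
      (((∏ j, ‖A j‖) ^ 2 : ℝ) : ℂ) •
        (Matrix.of fun a b => ∏ j, Matrix.gram ℂ (fun a => v a j) a b) -
        Matrix.of fun a b => ∏ j, Matrix.gram ℂ (fun a => A j (v a j)) a b := by
    ext a b
    simp [Finset.prod_mul_distrib, Finset.prod_pow]
  rw [hsplit, Matrix.sub_mulVec, dotProduct_sub, Matrix.smul_mulVec, dotProduct_smul,
    ← key v, ← key fun a j => A j (v a j), sub_nonneg, smul_eq_mul] at hPS
  have h6 : ‖∑ a, c a • T.tmul fun j => A j (v a j)‖ ^ 2 ≤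
      ((∏ j, ‖A j‖) * ‖∑ a, c a • T.tmul (v a)‖) ^ 2 := by
    rw [mul_pow]
    exact_mod_cast hPS
  have h7 := abs_le_of_sq_le_sq h6
    (mul_nonneg (Finset.prod_nonneg fun j _ => norm_nonneg _) (norm_nonneg _))
  simpa [ofAlg] using (le_abs_self _).trans h7

/-- `(⨂ A j) (⨂ v j) = ⨂ (A j (v j))`. -/
theorem tensorOp_tmul [CompleteSpace H] (T : HilbertTensor E H) (A : ∀ j, E j →L[ℂ] E j)
    (v : ∀ j, E j) : T.tensorOp A (T.tmul v) = T.tmul fun j => A j (v j) := by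
  have h := LinearMap.extendOfNorm_eq
    (f := T.ofAlg ∘ₗ PiTensorProduct.map fun j => (A j).toLinearMap)
    T.denseRange_ofAlg ⟨_, T.norm_ofAlg_map_le A⟩ (PiTensorProduct.tprod ℂ v)
  simpa [tensorOp, ofAlg] using h

end HilbertTensor

/-! ### Quantum behaviours in the `(n,2,2)` scenario -/

/-- A quantum experiment with `n` sites, two inputs and two outputs per site: Hilbert spaces of
arbitrary dimension at the sites, a density matrix on their tensor product, given as a
mixture `∑ w l |ψ l⟩⟨ψ l|` of pure states, and at every site a two-outcome POVM for each of the two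
inputs. -/
structure QuantumExperiment (n : ℕ) where
  /-- Hilbert space of site `j` -/
  E : Fin n → Type
  [normedE : ∀ j, NormedAddCommGroup (E j)]
  [innerE : ∀ j, InnerProductSpace ℂ (E j)]
  [completeE : ∀ j, CompleteSpace (E j)]
  /-- Hilbert space of the whole system -/
  H : Type
  [normedH : NormedAddCommGroup H]
  [innerH : InnerProductSpace ℂ H]
  [completeH : CompleteSpace H]
  /-- `H` is the tensor product of the `E j` -/
  tensor : HilbertTensor E H
  /-- weights of the mixture -/
  w : ℕ → ℝ
  w_nonneg : ∀ l, 0 ≤ w l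
  w_sum : HasSum w 1
  /-- pure states of the mixture -/
  ψ : ℕ → H
  norm_ψ : ∀ l, ‖ψ l‖ = 1
  /-- `povm j s m` is the effect of outcome `m` at site `j` on input `s` -/
  povm : ∀ j, ZMod 2 → ZMod 2 → (E j →L[ℂ] E j)
  povm_pos : ∀ j s m, (povm j s m).IsPositive
  povm_sum : ∀ j s, ∑ m, povm j s m = 1

attribute [instance] QuantumExperiment.normedE QuantumExperiment.innerE
  QuantumExperiment.completeE QuantumExperiment.normedH QuantumExperiment.innerH
  QuantumExperiment.completeH

namespace QuantumExperiment

variable {n : ℕ}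

/-- The Born rule `p(m|s) = Tr(ρ ⨂ P_j^{s_j, m_j})`. -/
def prob (Q : QuantumExperiment n) (s m : Fin n → ZMod 2) : ℝ :=
  ∑' l, Q.w l * (inner ℂ (Q.ψ l) (Q.tensor.tensorOp (fun j => Q.povm j (s j) (m j)) (Q.ψ l))).re

/-- The state is pure. -/
def IsPure (Q : QuantumExperiment n) : Prop := ∃ l, Q.w l = 1

end QuantumExperiment

/-! ### Linear Boolean functions and post-selection -/

/-- Linear Boolean functions: sums modulo 2 of some of the variables and of a constant. -/
def IsLinearBoolean {ι : Type} [Fintype ι] (f : (ι → ZMod 2) → ZMod 2) : Prop :=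
  ∃ (a : ι → ZMod 2) (b : ZMod 2), ∀ s, f s = ∑ i, a i * s i + b

/-- An output-input post-selection rule with `n` parties and a `k`-bit string `x`: the
data are accepted if `s j = g j x m^{∖j}` for every `j`, where `m^{∖j}` are the outputs of
the parties other than `j`. -/
abbrev PostSelection (n k : ℕ) : Type :=
  ∀ j : Fin n, (Fin k → ZMod 2) → ({i : Fin n // i ≠ j} → ZMod 2) → ZMod 2

namespace PostSelection

variable {n k : ℕ}

/-- The data `(m, s)` are accepted for the value `x`. -/
def Accepts (g : PostSelection n k) (x : Fin k → ZMod 2) (s m : Fin n → ZMod 2) : Prop :=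
  ∀ j, s j = g j x fun i => m i

/-- Linear output-input post-selection (LOI): every `g j` is a linear Boolean function of the
bits of `x` and of `m^{∖j}`. -/
def IsLOI (g : PostSelection n k) : Prop :=
  ∀ j, IsLinearBoolean fun y : Fin k ⊕ {i : Fin n // i ≠ j} → ZMod 2 =>
    g j (fun a => y (Sum.inl a)) fun i => y (Sum.inr i)

/-- Linear input post-selection (LI): every `g j` depends on `x` only, and is a linear
Boolean function of `x`. -/
def IsLI (g : PostSelection n k) : Prop :=
  ∃ h : Fin n → (Fin k → ZMod 2) → ZMod 2, (∀ j, IsLinearBoolean (h j)) ∧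
    ∀ j x m, g j x m = h j x

end PostSelection

open Classical in
/-- The joint probability, for uniformly random inputs `s`, that the data are accepted for `x`
and that `(s, m)` satisfy `C`. -/
def acceptedProb {n k : ℕ} (Q : QuantumExperiment n) (g : PostSelection n k)
    (x : Fin k → ZMod 2) (C : (Fin n → ZMod 2) → (Fin n → ZMod 2) → Prop) : ℝ :=
  ∑ s : Fin n → ZMod 2, ∑ m : Fin n → ZMod 2,
    if g.Accepts x s m ∧ C s m then (1 / 2 : ℝ) ^ n * Q.prob s m else 0

/-- `p` is the correlator `x ↦ p(1|x) = p(⊕ m_j = 1 | x)` of the experiment `Q` after the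
post-selection `g`: for every `x` data are accepted with positive probability, and `p x` is the
conditional probability, given acceptance, that the outputs sum to `1` modulo 2. -/
def IsCorrelator {n k : ℕ} (Q : QuantumExperiment n) (g : PostSelection n k)
    (p : (Fin k → ZMod 2) → ℝ) : Prop :=
  ∀ x, 0 < acceptedProb Q g x (fun _ _ => True) ∧
    p x = acceptedProb Q g x (fun _ m => ∑ j, m j = 1) / acceptedProb Q g x (fun _ _ => True)

/-- The space of `n`-party quantum correlators `p(1|x)`, `|x| = k`, under LI. -/
def liCorrelators (n k : ℕ) : Set ((Fin k → ZMod 2) → ℝ) :=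
  {p | ∃ (Q : QuantumExperiment n) (g : PostSelection n k), g.IsLI ∧ IsCorrelator Q g p}

/-- The space of `n`-party quantum correlators `p(1|x)`, `|x| = k`, under LOI. -/
def loiCorrelators (n k : ℕ) : Set ((Fin k → ZMod 2) → ℝ) :=
  {p | ∃ (Q : QuantumExperiment n) (g : PostSelection n k), g.IsLOI ∧ IsCorrelator Q g p}

/-- The deterministic correlator `p(1|x) = δ^1_{f(x)}`. -/
def vertex {k : ℕ} (f : (Fin k → ZMod 2) → ZMod 2) : (Fin k → ZMod 2) → ℝ :=
  fun x => if f x = 1 then 1 else 0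

/-- The product (AND) of all bits. -/
def prodFn (k : ℕ) : (Fin k → ZMod 2) → ZMod 2 := fun x => ∏ j, x j

/-- `f` can be performed deterministically by non-adaptive measurement-based quantum computation
(nMBQC) with `n` parties: on a pure `n`-partite resource state, with the measurement choices `s j`
computed from `x` as linear Boolean functions, the parity of the outcomes is `f x` with
certainty for every `x`. -/
def PerformedByNMBQC (n : ℕ) {k : ℕ} (f : (Fin k → ZMod 2) → ZMod 2) : Prop :=
  ∃ (Q : QuantumExperiment n) (h : Fin n → (Fin k → ZMod 2) → ZMod 2),
    Q.IsPure ∧ (∀ j, IsLinearBoolean (h j)) ∧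
      ∀ x, ∑ m with ∑ j, m j = f x, Q.prob (fun j => h j x) m = 1

end BellTest

end

/-! Lower bound under LI and for nMBQC. Let the inputs be `b j ⬝ᵥ x + c j` and let the parity be `f
x` with certainty. Write `B x` for the product of the two-outcome observables. Any state `ψ` of
positive weight satisfies `B x ψ = (-1)^(f x) ψ`. Suppose a nonzero `a` differs from every `b j`,
and take `e` with `a ⬝ᵥ e = 1`. The product of `B x * B (x + e)` over the hyperplane `a ⬝ᵥ x = 0`
multiplies `ψ` by `(-1)^(∑ f)`. At each site this is a word in two observables, which act on `ψ`
like two reflections. Each pair is therefore a power of one rotation, and the exponents sum to zero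
because `b j ≠ a`. The word fixes `ψ`, so `∑ f = 0` modulo 2 (`sum_eq_zero_of_parity`). The product
of all bits takes the value 1 exactly once, so all `2 ^ k - 1` nonzero vectors must occur among the
`b j`.

Upper bound. Equatorial measurements on a GHZ state have deterministic output parity when the angles
sum to a multiple of `π`. One qubit for each nonzero `a`, with input `a ⬝ᵥ x`, realises the
expansion of the product of bits into parities.

LOI. A three-qubit GHZ state with inputs `u`, `v`, `u + v` outputs the parity `u v + u`. In a chain
of `k - 1` such states, `u` is the parity of all earlier outputs and `v` is the next bit of `x`. The
parities then telescope to the product of all bits. Strict inclusion follows from `3 (k - 1) < 2 ^ k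
- 1` for `k ≥ 3`. -/

namespace BellTest

/-! ### Product operators on a Hilbert tensor product. -/

namespace HilbertTensor

variable {n : ℕ} {E : Fin n → Type} [∀ j, NormedAddCommGroup (E j)]
  [∀ j, InnerProductSpace ℂ (E j)] {H : Type} [NormedAddCommGroup H]
  [InnerProductSpace ℂ H]

/-- Continuous linear maps on a Hilbert tensor product are determined by product vectors. -/
theorem ext_tmul {F : Type*} [NormedAddCommGroup F] [NormedSpace ℂ F]
    (T : HilbertTensor E H) {f g : H →L[ℂ] F} (h : ∀ v, f (T.tmul v) = g (T.tmul v)) : f = g := by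
  refine ContinuousLinearMap.ext_on T.dense_span ?_
  rintro _ ⟨v, rfl⟩
  exact h v

variable [CompleteSpace H]

/-- `⨂ A j` as a monoid homomorphism in the family `A`. -/
noncomputable def tensorHom (T : HilbertTensor E H) : (∀ j, E j →L[ℂ] E j) →* (H →L[ℂ] H) where
  toFun := T.tensorOp
  map_one' := T.ext_tmul fun v => by simp [tensorOp_tmul]
  map_mul' A B := T.ext_tmul fun v => by simp [tensorOp_tmul]

theorem tensorHom_apply (T : HilbertTensor E H) (A : ∀ j, E j →L[ℂ] E j) :
    T.tensorHom A = T.tensorOp A := rfl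

theorem norm_tensorHom_apply_le (T : HilbertTensor E H) (A : ∀ j, E j →L[ℂ] E j) (x : H) :
    ‖T.tensorHom A x‖ ≤ (∏ j, ‖A j‖) * ‖x‖ := by
  refine T.denseRange_ofAlg.induction_on x ?_ fun z => ?_
  · exact isClosed_le (by fun_prop) (by fun_prop)
  · have h := LinearMap.extendOfNorm_eq
      (f := T.ofAlg ∘ₗ PiTensorProduct.map fun j => (A j).toLinearMap)
      T.denseRange_ofAlg ⟨_, T.norm_ofAlg_map_le A⟩ z
    rw [tensorHom_apply, tensorOp, h]
    exact T.norm_ofAlg_map_le A z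

theorem norm_tensorHom_apply_le_of_le_one (T : HilbertTensor E H) {A : ∀ j, E j →L[ℂ] E j}
    (hA : ∀ j, ‖A j‖ ≤ 1) (x : H) : ‖T.tensorHom A x‖ ≤ ‖x‖ := by
  refine (T.norm_tensorHom_apply_le A x).trans ?_
  exact mul_le_of_le_one_left (norm_nonneg _)
    (Finset.prod_le_one (fun j _ => norm_nonneg _) fun j _ => hA j)

/-- On product vectors this is symmetry of each factor. Density extends it to one argument at a
time, and conjugation exchanges the roles of the two arguments in between. -/
theorem inner_tensorHom (T : HilbertTensor E H) {A : ∀ j, E j →L[ℂ] E j}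
    (hA : ∀ j v w, inner ℂ (A j v) w = inner ℂ v (A j w)) (x y : H) :
    inner ℂ (T.tensorHom A x) y = inner ℂ x (T.tensorHom A y) := by
  have h1 : ∀ v, innerSL ℂ (T.tmul v) ∘L T.tensorHom A =
      innerSL ℂ (T.tensorHom A (T.tmul v)) := fun v =>
    T.ext_tmul fun w => by simp [tensorHom_apply, tensorOp_tmul, T.inner_tmul, hA]
  have h2 : innerSL ℂ y ∘L T.tensorHom A = innerSL ℂ (T.tensorHom A y) :=
    T.ext_tmul fun v => by
      have := congrArg star (DFunLike.congr_fun (h1 v) y)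
      simpa using this.symm
  have := congrArg star (DFunLike.congr_fun h2 x)
  simpa using this

theorem tensorHom_sum (T : HilbertTensor E H) {ι : Type} [Fintype ι] [DecidableEq ι]
    (A : ∀ j, ι → E j →L[ℂ] E j) :
    T.tensorHom (fun j => ∑ i, A j i) = ∑ m : Fin n → ι, T.tensorHom fun j => A j (m j) := by
  refine T.ext_tmul fun v => ?_
  simp only [tensorHom_apply, tensorOp_tmul, sum_apply]
  exact T.tmul.map_sum fun j i => A j i (v j)

theorem tensorHom_smul (T : HilbertTensor E H) (c : Fin n → ℂ) (A : ∀ j, E j →L[ℂ] E j) :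
    T.tensorHom (fun j => c j • A j) = (∏ j, c j) • T.tensorHom A := by
  refine T.ext_tmul fun v => ?_
  simp only [tensorHom_apply, tensorOp_tmul, smul_apply]
  exact T.tmul.map_smul_univ c _

/-- A product operator fixes a vector if each of its factors, acting on its own site, does. -/
theorem tensorHom_apply_eq_self (T : HilbertTensor E H) (A : ∀ j, E j →L[ℂ] E j) (x : H)
    (h : ∀ j, T.tensorHom (Pi.mulSingle j (A j)) x = x) : T.tensorHom A x = x := by
  have key : ∀ S : Finset (Fin n), T.tensorHom (fun j => if j ∈ S then A j else 1) x = x := by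
    intro S
    induction S using Finset.induction_on with
    | empty => simp [← Pi.one_def]
    | insert i S hi ih =>
      have e : (fun j => if j ∈ insert i S then A j else 1) =
          (fun j => if j ∈ S then A j else 1) * Pi.mulSingle i (A i) := by
        funext j
        by_cases hj : j = i
        · subst hj; simp [hi]
        · simp [hj]
      rw [e, map_mul, mul_apply_eq_comp, h, ih]
  simpa using key Finset.univ

end HilbertTensor

/-! ### Bits and signs. -/

theorem zmod_two_cases (b : ZMod 2) : b = 0 ∨ b = 1 := by
  revert b; decide

theorem sum_zmod_two {M : Type*} [AddCommMonoid M] (f : ZMod 2 → M) :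
    ∑ b, f b = f 0 + f 1 := Fin.sum_univ_two f

/-- The sign `(-1)^b`. -/
noncomputable def sgn (b : ZMod 2) : ℝ := if b = 0 then 1 else -1

@[simp] theorem sgn_zero : sgn 0 = 1 := by simp [sgn]

@[simp] theorem sgn_one : sgn 1 = -1 := by simp [sgn]

theorem sgn_add (a b : ZMod 2) : sgn (a + b) = sgn a * sgn b := by
  have h : (1 : ZMod 2) + 1 = 0 := by decide
  rcases zmod_two_cases a with rfl | rfl <;> rcases zmod_two_cases b with rfl | rfl <;> simp [h]

theorem sgn_sum {ι : Type*} (S : Finset ι) (f : ι → ZMod 2) :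
    sgn (∑ i ∈ S, f i) = ∏ i ∈ S, sgn (f i) := by
  induction S using Finset.cons_induction with
  | empty => simp
  | cons i S hi ih => simp [sgn_add, ih]

theorem sgn_eq_one_iff (b : ZMod 2) : sgn b = 1 ↔ b = 0 := by
  rcases zmod_two_cases b with rfl | rfl
  · simp
  · norm_num

theorem sgn_mul_self (b : ZMod 2) : sgn b * sgn b = 1 := by
  rcases zmod_two_cases b with rfl | rfl <;> simp

/-! ### Two-outcome observables and parities that are certain. -/

namespace QuantumExperiment

variable {n : ℕ}

/-- The effects commute because they sum to 1, so `⟪P v, R v⟫` is a sum of two nonnegative terms.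
Hence `‖P v - R v‖ ≤ ‖P v + R v‖ = ‖v‖`. No projectivity is needed, so general POVMs are covered
without dilation. -/
theorem norm_le_one_of_add_eq_one {E : Type*} [NormedAddCommGroup E] [InnerProductSpace ℂ E]
    [CompleteSpace E] {P R : E →L[ℂ] E} (hP : P.IsPositive) (hR : R.IsPositive)
    (h : P + R = 1) : ‖P - R‖ ≤ 1 := by
  refine ContinuousLinearMap.opNorm_le_bound _ zero_le_one fun v => ?_
  have hadd : ∀ w, P w + R w = w := fun w => by
    simpa using DFunLike.congr_fun h w
  have hcomm : R (P v) = P (R v) := by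
    have h2 : P (P v) + P (R v) = P v := by rw [← map_add, hadd]
    exact add_left_cancel ((hadd (P v)).trans h2.symm)
  have hre : 0 ≤ (inner ℂ (P v) (R v)).re := by
    have h1 : inner ℂ (P v) (R v) =
        inner ℂ (P v) (R (P v)) + inner ℂ (R v) (P (R v)) := by
      calc inner ℂ (P v) (R v) = inner ℂ (P v) (R (P v + R v)) := by rw [hadd]
        _ = _ := by
          rw [map_add, inner_add_right, ← hR.inner_left_eq_inner_right (P v) (R v), hcomm,
            hP.inner_left_eq_inner_right (R v) (R v)]
    rw [h1, Complex.add_re]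
    exact add_nonneg (hR.re_inner_nonneg_right _) (hP.re_inner_nonneg_right _)
  have h1 := norm_sub_sq (𝕜 := ℂ) (P v) (R v)
  have h2 := norm_add_sq (𝕜 := ℂ) (P v) (R v)
  rw [hadd] at h2
  rw [one_mul]
  refine abs_le_of_sq_le_sq' ?_ (norm_nonneg _) |>.2
  change 0 ≤ RCLike.re (inner ℂ (P v) (R v)) at hre
  rw [sub_apply]
  linarith

/-- The observable with values `±1` measured at site `j` on input `s`. -/
noncomputable def obs (Q : QuantumExperiment n) (j : Fin n) (s : ZMod 2) : Q.E j →L[ℂ] Q.E j :=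
  Q.povm j s 0 - Q.povm j s 1

theorem povm_add (Q : QuantumExperiment n) (j : Fin n) (s : ZMod 2) :
    Q.povm j s 0 + Q.povm j s 1 = 1 := by
  rw [← Q.povm_sum j s, sum_zmod_two]

theorem norm_obs_le (Q : QuantumExperiment n) (j : Fin n) (s : ZMod 2) : ‖Q.obs j s‖ ≤ 1 :=
  norm_le_one_of_add_eq_one (Q.povm_pos j s 0) (Q.povm_pos j s 1) (Q.povm_add j s)

theorem inner_obs (Q : QuantumExperiment n) (j : Fin n) (s : ZMod 2) (v w : Q.E j) :
    inner ℂ (Q.obs j s v) w = inner ℂ v (Q.obs j s w) := by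
  simp only [obs, sub_apply, inner_sub_left, inner_sub_right,
    (Q.povm_pos j s _).inner_left_eq_inner_right]

/-- The expectation value of the product of the observables in the `l`-th state. -/
noncomputable def parityMean (Q : QuantumExperiment n) (s : Fin n → ZMod 2) (l : ℕ) : ℝ :=
  (inner ℂ (Q.ψ l) (Q.tensor.tensorHom (fun j => Q.obs j (s j)) (Q.ψ l))).re

theorem parityMean_eq (Q : QuantumExperiment n) (s : Fin n → ZMod 2) (l : ℕ) :
    Q.parityMean s l = ∑ m : Fin n → ZMod 2, sgn (∑ j, m j) *
      (inner ℂ (Q.ψ l) (Q.tensor.tensorOp (fun j => Q.povm j (s j) (m j)) (Q.ψ l))).re := by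
  have h : (fun j => Q.obs j (s j)) =
      fun j => ∑ b : ZMod 2, ((sgn b : ℝ) : ℂ) • Q.povm j (s j) b := by
    funext j
    simp [sum_zmod_two, obs, sub_eq_add_neg]
  rw [parityMean, h, Q.tensor.tensorHom_sum fun j b => ((sgn b : ℝ) : ℂ) • Q.povm j (s j) b]
  simp_rw [Q.tensor.tensorHom_smul]
  simp only [sum_apply, smul_apply, inner_sum, inner_smul_right,
    Complex.re_sum]
  refine Finset.sum_congr rfl fun m _ => ?_
  rw [← Complex.ofReal_prod, Complex.re_ofReal_mul, sgn_sum, HilbertTensor.tensorHom_apply]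

/-- The `l`-th term of the Born rule, without its weight. -/
noncomputable def pureProb (Q : QuantumExperiment n) (s m : Fin n → ZMod 2) (l : ℕ) : ℝ :=
  (inner ℂ (Q.ψ l) (Q.tensor.tensorOp (fun j => Q.povm j (s j) (m j)) (Q.ψ l))).re

theorem sum_pureProb (Q : QuantumExperiment n) (s : Fin n → ZMod 2) (l : ℕ) :
    ∑ m, Q.pureProb s m l = 1 := by
  have h := Q.tensor.tensorHom_sum fun j b => Q.povm j (s j) b
  have h1 : (fun j => ∑ b, Q.povm j (s j) b) = 1 := funext fun j => Q.povm_sum j (s j)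
  rw [h1, map_one] at h
  have h2 := congrArg (fun A : Q.H →L[ℂ] Q.H => (inner ℂ (Q.ψ l) (A (Q.ψ l))).re) h
  simp only [sum_apply, inner_sum, Complex.re_sum, HilbertTensor.tensorHom_apply] at h2
  unfold pureProb
  rw [← h2]
  simp [inner_self_eq_norm_sq_to_K, Q.norm_ψ]

theorem norm_povm_le (Q : QuantumExperiment n) (j : Fin n) (s m : ZMod 2) :
    ‖Q.povm j s m‖ ≤ 1 := by
  have h1 : (2 : ℂ) • Q.povm j s 0 = 1 + Q.obs j s := by
    rw [two_smul, ← Q.povm_add j s, obs]; abel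
  have h2 : (2 : ℂ) • Q.povm j s 1 = 1 - Q.obs j s := by
    rw [two_smul, ← Q.povm_add j s, obs]; abel
  have h3 : ‖(1 : Q.E j →L[ℂ] Q.E j)‖ ≤ 1 := ContinuousLinearMap.norm_id_le
  have h4 := Q.norm_obs_le j s
  rcases zmod_two_cases m with rfl | rfl
  · have := norm_add_le (1 : Q.E j →L[ℂ] Q.E j) (Q.obs j s)
    rw [← h1, norm_smul, Complex.norm_ofNat] at this
    linarith
  · have := norm_sub_le (1 : Q.E j →L[ℂ] Q.E j) (Q.obs j s)
    rw [← h2, norm_smul, Complex.norm_ofNat] at this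
    linarith

theorem abs_pureProb_le (Q : QuantumExperiment n) (s m : Fin n → ZMod 2) (l : ℕ) :
    |Q.pureProb s m l| ≤ 1 := by
  refine (Complex.abs_re_le_norm _).trans ((norm_inner_le_norm _ _).trans ?_)
  have h := Q.tensor.norm_tensorHom_apply_le_of_le_one
    (fun j => Q.norm_povm_le j (s j) (m j)) (Q.ψ l)
  rw [Q.norm_ψ] at h ⊢
  rwa [one_mul]

/-- The Born rule is a `tsum`, which takes the default value 0 without summability; domination by
the weights rules this out. -/
theorem summable_prob (Q : QuantumExperiment n) (s m : Fin n → ZMod 2) :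
    Summable fun l => Q.w l * Q.pureProb s m l := by
  refine Summable.of_norm_bounded Q.w_sum.summable fun l => ?_
  rw [norm_mul, Real.norm_eq_abs, Real.norm_eq_abs, abs_of_nonneg (Q.w_nonneg l)]
  exact mul_le_of_le_one_right (Q.w_nonneg l) (Q.abs_pureProb_le s m l)

theorem hasSum_prob (Q : QuantumExperiment n) (s m : Fin n → ZMod 2) :
    HasSum (fun l => Q.w l * Q.pureProb s m l) (Q.prob s m) :=
  (Q.summable_prob s m).hasSum

theorem sum_prob (Q : QuantumExperiment n) (s : Fin n → ZMod 2) : ∑ m, Q.prob s m = 1 := by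
  have h := hasSum_sum fun m (_ : m ∈ Finset.univ) => Q.hasSum_prob s m
  simp_rw [← Finset.mul_sum, Q.sum_pureProb, mul_one] at h
  exact h.unique Q.w_sum

theorem hasSum_parityMean (Q : QuantumExperiment n) (s : Fin n → ZMod 2) :
    HasSum (fun l => Q.w l * Q.parityMean s l) (∑ m, sgn (∑ j, m j) * Q.prob s m) := by
  have h := hasSum_sum fun m (_ : m ∈ Finset.univ) =>
    (Q.hasSum_prob s m).mul_left (sgn (∑ j, m j))
  refine h.congr_fun fun l => ?_
  rw [parityMean_eq, Finset.mul_sum]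
  exact Finset.sum_congr rfl fun m _ => by rw [pureProb]; ring

theorem norm_tensorHom_obs_le (Q : QuantumExperiment n) (s : Fin n → ZMod 2) (x : Q.H) :
    ‖Q.tensor.tensorHom (fun j => Q.obs j (s j)) x‖ ≤ ‖x‖ :=
  Q.tensor.norm_tensorHom_apply_le_of_le_one (fun j => Q.norm_obs_le j (s j)) x

theorem abs_parityMean_le (Q : QuantumExperiment n) (s : Fin n → ZMod 2) (l : ℕ) :
    |Q.parityMean s l| ≤ 1 := by
  refine (Complex.abs_re_le_norm _).trans ((norm_inner_le_norm _ _).trans ?_)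
  have h := Q.norm_tensorHom_obs_le s (Q.ψ l)
  rw [Q.norm_ψ] at h ⊢
  rwa [one_mul]

/-- If the outputs have parity `b` with certainty, every state of the mixture of positive weight
is an eigenvector of the product of the observables. -/
theorem tensorHom_obs_apply (Q : QuantumExperiment n) {s : Fin n → ZMod 2} {b : ZMod 2}
    (h : ∑ m with ∑ j, m j = b, Q.prob s m = 1) {l : ℕ} (hl : 0 < Q.w l) :
    Q.tensor.tensorHom (fun j => Q.obs j (s j)) (Q.ψ l) = ((sgn b : ℝ) : ℂ) • Q.ψ l := by
  have h1 : ∑ m, sgn (∑ j, m j) * Q.prob s m = sgn b := by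
    have e := Q.sum_prob s
    rw [← Finset.sum_filter_add_sum_filter_not _ (fun m => ∑ j, m j = b), h] at e
    rw [← Finset.sum_filter_add_sum_filter_not _ (fun m => ∑ j, m j = b)]
    have e1 : ∑ m with ∑ j, m j = b, sgn (∑ j, m j) * Q.prob s m = sgn b := by
      rw [← mul_one (sgn b), ← h, Finset.mul_sum]
      exact Finset.sum_congr rfl fun m hm => by rw [(Finset.mem_filter.1 hm).2]
    have e2 : ∑ m with ¬ ∑ j, m j = b, sgn (∑ j, m j) * Q.prob s m = 0 := by
      have : ∑ m with ¬ ∑ j, m j = b, sgn (∑ j, m j) * Q.prob s m =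
          sgn (b + 1) * ∑ m with ¬ ∑ j, m j = b, Q.prob s m := by
        rw [Finset.mul_sum]
        refine Finset.sum_congr rfl fun m hm => ?_
        have hm := (Finset.mem_filter.1 hm).2
        congr 2
        generalize ∑ j, m j = c at hm
        have key : ∀ b c : ZMod 2, ¬ c = b → c = b + 1 := by decide
        exact key b c hm
      rw [this, left_eq_add.1 e.symm, mul_zero]
    rw [e1, e2, add_zero]
  -- The signed means are at most 1 and their weighted average is 1, so each mean of positive weight
  -- attains the bound.
  have h2 : sgn b * Q.parityMean s l = 1 := by
    have hle : ∀ l, sgn b * Q.parityMean s l ≤ 1 := fun l => by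
      have := abs_le.1 (Q.abs_parityMean_le s l)
      rcases zmod_two_cases b with rfl | rfl
      · simpa using this.2
      · simp; linarith [this.1]
    have hs := (Q.hasSum_parityMean s).mul_left (sgn b)
    rw [h1, sgn_mul_self] at hs
    have hd := Q.w_sum.sub hs
    have hnn : 0 ≤ fun l => Q.w l - sgn b * (Q.w l * Q.parityMean s l) := fun l => by
      have := mul_le_mul_of_nonneg_left (hle l) (Q.w_nonneg l)
      change 0 ≤ Q.w l - sgn b * (Q.w l * Q.parityMean s l)
      linarith
    rw [sub_self, hasSum_zero_iff_of_nonneg hnn] at hd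
    have h3 : Q.w l - sgn b * (Q.w l * Q.parityMean s l) = 0 := congrFun hd l
    have : Q.w l * (1 - sgn b * Q.parityMean s l) = 0 := by linarith
    rcases mul_eq_zero.1 this with h | h
    · exact absurd h hl.ne'
    · linarith
  set M := Q.tensor.tensorHom (fun j => Q.obs j (s j))
  -- Equality case of Cauchy–Schwarz: with `M` a contraction, the squared distance is at most `1 - 2
  -- + 1 = 0`.
  have h3 := norm_sub_sq (𝕜 := ℂ) (((sgn b : ℝ) : ℂ) • Q.ψ l) (M (Q.ψ l))
  rw [inner_smul_left, Complex.conj_ofReal, norm_smul, Complex.norm_real, Q.norm_ψ,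
    Real.norm_eq_abs, mul_one, sq_abs, sq (sgn b), sgn_mul_self] at h3
  have h4 : RCLike.re (((sgn b : ℝ) : ℂ) * inner ℂ (Q.ψ l) (M (Q.ψ l))) = 1 := by
    rw [← h2]
    exact Complex.re_ofReal_mul _ _
  have h5 := Q.norm_tensorHom_obs_le s (Q.ψ l)
  rw [Q.norm_ψ] at h5
  have h6 : ‖M (Q.ψ l)‖ ^ 2 ≤ 1 := pow_le_one₀ (norm_nonneg _) h5
  rw [h4] at h3
  have h7 : ‖((sgn b : ℝ) : ℂ) • Q.ψ l - M (Q.ψ l)‖ = 0 :=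
    pow_eq_zero_iff two_ne_zero |>.1 (le_antisymm (by linarith) (sq_nonneg _))
  exact (sub_eq_zero.1 (norm_eq_zero.1 h7)).symm

theorem exists_weight_pos (Q : QuantumExperiment n) : ∃ l, 0 < Q.w l := by
  by_contra! h
  have : Q.w = 0 := funext fun l => le_antisymm (h l) (Q.w_nonneg l)
  have h1 := Q.w_sum
  rw [this] at h1
  exact zero_ne_one (hasSum_zero.unique h1)

end QuantumExperiment

/-! ### Dihedral words in two symmetric contractions. -/

/-- Products of two involutions of a dihedral group: if `u x` depends on the bit `s x` only, the
products `u x * u y` are powers of one rotation. -/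
theorem exists_zpow_of_involutions {G ι : Type*} [Group G] (u : ι → G) (s : ι → ZMod 2)
    (hu : ∀ x, u x * u x = 1) (hs : ∀ x y, s x = s y → u x = u y) :
    ∃ r : G, ∀ x y, u x * u y = r ^ (((s y).val : ℤ) - (s x).val) := by
  by_cases h : ∃ x y, s x = 0 ∧ s y = 1
  · obtain ⟨x₀, y₀, hx₀, hy₀⟩ := h
    -- The rotation is the product of the two reflections; the opposite order gives its inverse, and
    -- equal bits cancel.
    refine ⟨u x₀ * u y₀, fun x y => ?_⟩
    have hv : ((1 : ZMod 2).val : ℤ) = 1 := rfl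
    rcases zmod_two_cases (s x) with hx | hx <;> rcases zmod_two_cases (s y) with hy | hy
    · rw [hs x y (hx.trans hy.symm), hu, hx, hy, sub_self, zpow_zero]
    · simp [hs x x₀ (hx.trans hx₀.symm), hs y y₀ (hy.trans hy₀.symm), hx, hy, hv]
    · simp only [hs x y₀ (hx.trans hy₀.symm), hs y x₀ (hy.trans hx₀.symm), hx, hy, hv,
        ZMod.val_zero, Nat.cast_zero, zero_sub, zpow_neg, zpow_one, mul_inv_rev]
      rw [inv_eq_of_mul_eq_one_left (hu x₀), inv_eq_of_mul_eq_one_left (hu y₀)]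
    · rw [hs x y (hx.trans hy.symm), hu, hx, hy, sub_self, zpow_zero]
  · push Not at h
    refine ⟨1, fun x y => ?_⟩
    have : s x = s y := by
      rcases zmod_two_cases (s x) with hx | hx <;> rcases zmod_two_cases (s y) with hy | hy
      · rw [hx, hy]
      · exact absurd hy (h x y hx)
      · exact absurd hx (h y x hy)
      · rw [hx, hy]
    rw [hs x y this, hu, one_zpow]

section Words

variable {H : Type*} [NormedAddCommGroup H] [InnerProductSpace ℂ H] {ι : Type*}

/-- A symmetric contraction squares to the identity on vectors whose norm it preserves. -/
theorem apply_apply_eq_self {A : H →L[ℂ] H} (hA : ∀ v w, inner ℂ (A v) w = inner ℂ v (A w))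
    (hn : ∀ v, ‖A v‖ ≤ ‖v‖) {v : H} (hv : ‖A v‖ = ‖v‖) : A (A v) = v := by
  have h1 := norm_sub_sq (𝕜 := ℂ) (A (A v)) v
  rw [hA (A v) v, inner_self_eq_norm_sq, hv] at h1
  have h2 := pow_le_pow_left₀ (norm_nonneg _) ((hn (A v)).trans_eq hv) 2
  have h3 : ‖A (A v) - v‖ = 0 :=
    pow_eq_zero_iff two_ne_zero |>.1 (le_antisymm (by linarith) (sq_nonneg _))
  exact sub_eq_zero.1 (norm_eq_zero.1 h3)

/-- Two symmetric contractions `t 0`, `t 1`, all of whose occurring words preserve the norm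
of `ψ`, act on `ψ` like the generators of a dihedral group. -/
theorem prod_map_apply_eq_self (t : ZMod 2 → H →L[ℂ] H) (s : ι → ZMod 2)
    (ht : ∀ b v w, inner ℂ (t b v) w = inner ℂ v (t b w)) (hn : ∀ b v, ‖t b v‖ ≤ ‖v‖)
    (ψ : H) (hψ : ∀ l : List ι, ‖(l.map fun x => t (s x)).prod ψ‖ = ‖ψ‖)
    (L : List (ι × ι)) (hL : (L.map fun p => ((s p.2).val : ℤ) - (s p.1).val).sum = 0) :
    (L.map fun p => t (s p.1) * t (s p.2)).prod ψ = ψ := by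
  -- The operators need not be invertible on `H`. On `K`, which contains `ψ` and is stable under
  -- them, they restrict to involutions, hence to permutations, and the group identity applies.
  -- Linearity of `K` plays no role.
  let K : Set H := {φ | ∀ (l : List ι) (x : ι),
    t (s x) (t (s x) ((l.map fun x => t (s x)).prod φ)) = (l.map fun x => t (s x)).prod φ}
  have hψK : ψ ∈ K := fun l x => by
    refine apply_apply_eq_self (ht _) (hn _) ?_
    rw [hψ l]
    simpa using hψ (x :: l)
  have hK : ∀ x, ∀ φ ∈ K, t (s x) φ ∈ K := fun x φ hφ l y => by
    simpa using hφ (l ++ [x]) y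
  let f : ι → K → K := fun x φ => ⟨t (s x) φ, hK x φ φ.2⟩
  have hf : ∀ x, Function.Involutive (f x) := fun x φ => Subtype.ext (φ.2 [] x)
  let u : ι → Equiv.Perm K := fun x => (hf x).toPerm
  obtain ⟨r, hr⟩ := exists_zpow_of_involutions u s
    (fun x => Equiv.ext fun φ => hf x φ) fun x y hxy => Equiv.ext fun φ => by
      apply Subtype.ext
      change t (s x) φ = t (s y) φ
      rw [hxy]
  have h1 : ∀ M : List (ι × ι), (M.map fun p => u p.1 * u p.2).prod =
      r ^ (M.map fun p => ((s p.2).val : ℤ) - (s p.1).val).sum := fun M => by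
    induction M with
    | nil => simp
    | cons p M ih =>
      rw [List.map_cons, List.prod_cons, ih, hr, List.map_cons, List.sum_cons, zpow_add]
  have h2 : ∀ (M : List (ι × ι)) (φ : K), (((M.map fun p => u p.1 * u p.2).prod φ : K) : H) =
      (M.map fun p => t (s p.1) * t (s p.2)).prod (φ : H) := fun M φ => by
    induction M with
    | nil => simp
    | cons p M ih =>
      simp only [List.map_cons, List.prod_cons, Equiv.Perm.mul_apply,
        mul_apply_eq_comp, ← ih]
      rfl
  have h3 := h2 L ⟨ψ, hψK⟩
  rw [h1, hL] at h3
  simpa using h3.symm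

end Words

/-! ### Affine functions over the field with two elements. -/

section Hyperplane

variable {k : ℕ}

theorem add_self_zmod_two {ι : Type*} (x : ι → ZMod 2) : x + x = 0 :=
  funext fun i => CharTwo.add_self_eq_zero (x i)

theorem exists_dotProduct_eq_one {a : Fin k → ZMod 2} (ha : a ≠ 0) :
    ∃ e : Fin k → ZMod 2, a ⬝ᵥ e = 1 := by
  obtain ⟨i, hi⟩ := Function.ne_iff.1 ha
  refine ⟨Pi.single i 1, ?_⟩
  rw [dotProduct_single, mul_one]
  exact (zmod_two_cases _).resolve_left hi

/-- An affine function that is not parallel to `a` is balanced along the pairs `x`, `x + e`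
across the hyperplane `a ⬝ᵥ x = 0`. -/
theorem sum_hyperplane_val_sub (a e b : Fin k → ZMod 2) (c : ZMod 2) (hae : a ⬝ᵥ e = 1)
    (hab : b ≠ a) :
    ∑ x with a ⬝ᵥ x = 0, (((b ⬝ᵥ (x + e) + c).val : ℤ) - (b ⬝ᵥ x + c).val) = 0 := by
  rcases zmod_two_cases (b ⬝ᵥ e) with hbe | hbe
  · refine Finset.sum_eq_zero fun x _ => ?_
    rw [dotProduct_add, hbe, add_zero, sub_self]
  -- Translation by `d` stays in the hyperplane and flips the value of the affine function, so it
  -- pairs summands of opposite sign. A vector separating `a` from `b` serves as `d`, after adding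
  -- `e` if it leaves the hyperplane.
  obtain ⟨d, hd⟩ : ∃ d, a ⬝ᵥ d = 0 ∧ b ⬝ᵥ d = 1 := by
    obtain ⟨d, hd⟩ := exists_dotProduct_eq_one (a := b - a) (sub_ne_zero.2 hab)
    rw [sub_dotProduct] at hd
    rcases zmod_two_cases (a ⬝ᵥ d) with h | h
    · exact ⟨d, h, by rwa [h, sub_zero] at hd⟩
    · refine ⟨d + e, ?_, ?_⟩
      · rw [dotProduct_add, h, hae]; decide
      · rw [dotProduct_add, hbe, sub_eq_iff_eq_add.1 hd, h]; decide
  have key : ∀ z : ZMod 2, (((z + 1).val : ℤ) - z.val) + ((z + 1 + 1).val - (z + 1).val) = 0 := by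
    decide
  refine Finset.sum_involution (fun x _ => x + d) (fun x _ => ?_) (fun x _ _ h => ?_)
    (fun x hx => ?_) fun x _ => ?_
  · have := key (b ⬝ᵥ x + c)
    rw [dotProduct_add, dotProduct_add, dotProduct_add, hbe, hd.2]
    convert this using 5 <;> ring_nf
  · have : d = 0 := by simpa using h
    simp [this] at hd
  · simpa [dotProduct_add, hd.1] using hx
  · simp [add_assoc, add_self_zmod_two]

/-- Translation by `e` exchanges the hyperplane with its complement. -/
theorem sum_hyperplane_add (a e : Fin k → ZMod 2) (hae : a ⬝ᵥ e = 1)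
    (f : (Fin k → ZMod 2) → ZMod 2) :
    ∑ x with a ⬝ᵥ x = 0, (f x + f (x + e)) = ∑ x, f x := by
  rw [Finset.sum_add_distrib,
    ← Finset.sum_filter_add_sum_filter_not Finset.univ (fun x => a ⬝ᵥ x = 0) f]
  congr 1
  refine Finset.sum_nbij' (· + e) (· + e) ?_ ?_ ?_ ?_ fun x _ => rfl
  · intro x hx
    simp only [Finset.mem_filter, Finset.mem_univ, true_and] at hx ⊢
    rw [dotProduct_add, hx, hae]; decide
  · intro x hx
    simp only [Finset.mem_filter, Finset.mem_univ, true_and] at hx ⊢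
    rw [dotProduct_add, (zmod_two_cases _).resolve_left hx, hae]; decide
  · intro x _; simp [add_assoc, add_self_zmod_two]
  · intro x _; simp [add_assoc, add_self_zmod_two]

end Hyperplane

/-! ### The parity obstruction and the lower bound on the number of parties. -/

namespace QuantumExperiment

variable {n k : ℕ}

theorem norm_one_clm_le (E : Type*) [NormedAddCommGroup E] [NormedSpace ℂ E] :
    ‖(1 : E →L[ℂ] E)‖ ≤ 1 := ContinuousLinearMap.norm_id_le

/-- If an experiment outputs the parity `f x` with certainty, the inputs being affine functions
of `x`, and some nonzero linear functional occurs in none of them, then `f` takes the value `1`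
an even number of times. -/
theorem sum_eq_zero_of_parity (Q : QuantumExperiment n) (b : Fin n → Fin k → ZMod 2)
    (c : Fin n → ZMod 2) (f : (Fin k → ZMod 2) → ZMod 2)
    (hf : ∀ x, ∑ m with ∑ j, m j = f x, Q.prob (fun j => b j ⬝ᵥ x + c j) m = 1)
    {a : Fin k → ZMod 2} (ha : a ≠ 0) (hb : ∀ j, b j ≠ a) : ∑ x, f x = 0 := by
  obtain ⟨l, hl⟩ := Q.exists_weight_pos
  obtain ⟨e, he⟩ := exists_dotProduct_eq_one ha
  set T := Q.tensor.tensorHom with hT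
  set ψ := Q.ψ l with hψdef
  have hψ : ψ ≠ 0 := by
    rw [← norm_ne_zero_iff, hψdef, Q.norm_ψ]; exact one_ne_zero
  let B : (Fin k → ZMod 2) → ∀ j, Q.E j →L[ℂ] Q.E j := fun x j => Q.obs j (b j ⬝ᵥ x + c j)
  have hB : ∀ x, T (B x) ψ = sgn (f x) • ψ := fun x => by
    rw [← Complex.coe_smul]
    exact Q.tensorHom_obs_apply (hf x) hl
  have hprod : ∀ M : List (Fin k → ZMod 2),
      T (M.map B).prod ψ = sgn (M.map f).sum • ψ := fun M => by
    induction M with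
    | nil => simp
    | cons x M ih =>
      simp [ih, hB, smul_smul, sgn_add, mul_comm]
  -- A word in the `B x` preserves `‖ψ‖` and factors into a word at site `j` and a word at the other
  -- sites. Both are contractions, so the word at site `j` alone must already preserve the norm.
  have hsite : ∀ j (M : List (Fin k → ZMod 2)),
      ‖(M.map fun x => T (Pi.mulSingle j (B x j))).prod ψ‖ = ‖ψ‖ := fun j M => by
    have hle : ∀ (N : List (Fin k → ZMod 2)) (v : Q.H),
        ‖(N.map fun x => T (Pi.mulSingle j (B x j))).prod v‖ ≤ ‖v‖ := fun N v => by
      induction N with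
      | nil => simp
      | cons x N ih =>
        refine le_trans ?_ ih
        rw [List.map_cons, List.prod_cons]
        refine Q.tensor.norm_tensorHom_apply_le_of_le_one (fun i => ?_) _
        by_cases hi : i = j
        · subst hi; simpa using Q.norm_obs_le _ _
        · simpa [hi] using norm_one_clm_le _
    have hle' : ∀ (N : List (Fin k → ZMod 2)) (v : Q.H),
        ‖(N.map fun x => T (Function.update (B x) j 1)).prod v‖ ≤ ‖v‖ := fun N v => by
      induction N with
      | nil => simp
      | cons x N ih =>
        refine le_trans ?_ ih
        rw [List.map_cons, List.prod_cons]
        refine Q.tensor.norm_tensorHom_apply_le_of_le_one (fun i => ?_) _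
        by_cases hi : i = j
        · subst hi; simpa using norm_one_clm_le _
        · simpa [hi] using Q.norm_obs_le _ _
    refine le_antisymm (hle M ψ) ?_
    have hfac : (M.map B).prod = (M.map fun x => Function.update (B x) j 1).prod *
        (M.map fun x => Pi.mulSingle j (B x j)).prod := by
      funext i
      rw [Pi.mul_apply, Pi.list_prod_apply, Pi.list_prod_apply, Pi.list_prod_apply]
      by_cases hi : i = j
      · subst hi; simp [List.map_map, Function.comp_def]
      · simp [List.map_map, Function.comp_def, hi]
    have h1 := hprod M
    rw [hfac, map_mul, map_list_prod, map_list_prod, List.map_map, List.map_map] at h1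
    have h2 := hle' M ((M.map fun x => T (Pi.mulSingle j (B x j))).prod ψ)
    refine le_trans (le_of_eq ?_) h2
    have h3 := congrArg norm h1
    have h4 : ‖sgn (M.map f).sum‖ = 1 := by
      rcases zmod_two_cases (M.map f).sum with h | h <;> simp [h]
    rw [norm_smul, h4, one_mul] at h3
    exact h3.symm
  let L : List ((Fin k → ZMod 2) × (Fin k → ZMod 2)) :=
    (Finset.univ.filter fun x => a ⬝ᵥ x = 0).toList.map fun x => (x, x + e)
  -- At every site the rotation exponents along `L` sum to zero, so each factor fixes `ψ`
  -- separately.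
  have hid : T (L.map fun p => B p.1 * B p.2).prod ψ = ψ := by
    refine Q.tensor.tensorHom_apply_eq_self _ ψ fun j => ?_
    have h := prod_map_apply_eq_self (fun z => T (Pi.mulSingle j (Q.obs j z)))
      (fun x => b j ⬝ᵥ x + c j) (fun z => Q.tensor.inner_tensorHom fun i v w => ?_)
      (fun z => Q.tensor.norm_tensorHom_apply_le_of_le_one fun i => ?_) ψ (hsite j) L ?_
    · convert h using 2
      rw [Pi.list_prod_apply, List.map_map, hT, ← MonoidHom.mulSingle_apply, map_list_prod,
        map_list_prod, List.map_map, List.map_map]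
      congr 1
      refine List.map_congr_left fun p _ => ?_
      simp [B, Pi.mulSingle_mul]
    · by_cases hi : i = j
      · subst hi; simpa using Q.inner_obs _ _ v w
      · simp [hi]
    · by_cases hi : i = j
      · subst hi; simpa using Q.norm_obs_le _ _
      · simpa [hi] using norm_one_clm_le _
    · have := sum_hyperplane_val_sub a e (b j) (c j) he (hb j)
      rw [← Finset.sum_map_toList] at this
      simpa [L, List.map_map, Function.comp_def] using this
  -- The same word is now evaluated through the eigenvalues of the global operators.
  have hsgn : T (L.map fun p => B p.1 * B p.2).prod ψ =
      sgn (L.map fun p => f p.1 + f p.2).sum • ψ := by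
    generalize L = L
    induction L with
    | nil => simp
    | cons p L ih => 
      simp only [List.map_cons, List.prod_cons, map_mul, mul_apply_eq_comp, ih, hB,
        ContinuousLinearMap.map_smul_of_tower, smul_smul, List.sum_cons, sgn_add]
      congr 1
      ring
  have hsum : (L.map fun p => f p.1 + f p.2).sum = ∑ x, f x := by
    rw [← sum_hyperplane_add a e he f, ← Finset.sum_map_toList]
    simp [L, List.map_map, Function.comp_def]
  rw [hid, hsum] at hsgn
  have h1 : (1 - sgn (∑ x, f x)) • ψ = 0 := by
    rw [sub_smul, one_smul, ← hsgn, sub_self]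
  rcases smul_eq_zero.1 h1 with h | h
  · rw [← sgn_eq_one_iff]
    exact (sub_eq_zero.1 h).symm
  · exact absurd h hψ

end QuantumExperiment

/-- Distributivity turns the sum into `∏ (0 + 1)`. -/
theorem sum_prodFn (k : ℕ) : ∑ x, prodFn k x = 1 := by
  have h := Finset.prod_univ_sum (fun _ : Fin k => (Finset.univ : Finset (ZMod 2)))
    fun _ b => b
  rw [Fintype.piFinset_univ] at h
  simp only [prodFn]
  rw [← h]
  simp [sum_zmod_two]

/-- Computing the product of `k` bits deterministically from affine inputs takes at least
`2 ^ k - 1` parties. -/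
theorem le_of_parity_eq_prodFn {n k : ℕ} (Q : QuantumExperiment n)
    (h : Fin n → (Fin k → ZMod 2) → ZMod 2) (hh : ∀ j, IsLinearBoolean (h j))
    (hf : ∀ x, ∑ m with ∑ j, m j = prodFn k x, Q.prob (fun j => h j x) m = 1) :
    2 ^ k - 1 ≤ n := by
  choose b c hbc using hh
  have hbc' : ∀ x, (fun j => h j x) = fun j => b j ⬝ᵥ x + c j := fun x =>
    funext fun j => hbc j x
  simp_rw [hbc'] at hf
  by_contra! hn
  obtain ⟨a, ha, hab⟩ : ∃ a : Fin k → ZMod 2, a ≠ 0 ∧ ∀ j, b j ≠ a := by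
    by_contra! hcon
    have hsub : (Finset.univ : Finset (Fin k → ZMod 2)) ⊆ insert 0 (Finset.univ.image b) := by
      intro a _
      by_cases ha : a = 0
      · simp [ha]
      · obtain ⟨j, hj⟩ := hcon a ha
        simp [← hj]
    have h1 := Finset.card_le_card hsub
    have h2 := Finset.card_insert_le (0 : Fin k → ZMod 2) (Finset.univ.image b)
    have h3 := Finset.card_image_le (s := Finset.univ) (f := b)
    simp only [Finset.card_univ, Fintype.card_fun, ZMod.card, Fintype.card_fin] at h1 h3
    omega
  have := Q.sum_eq_zero_of_parity b c (prodFn k) hf ha hab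
  rw [sum_prodFn] at this
  exact one_ne_zero this

/-! ### Qubit registers and equatorial measurements. -/

namespace Qubits

variable {n : ℕ}

/-- The state space of `n` qubits. -/
abbrev Space (n : ℕ) : Type := EuclideanSpace ℂ (Fin n → ZMod 2)

/-- The state space of one qubit. -/
abbrev Qubit : Type := EuclideanSpace ℂ (ZMod 2)

/-- The product vector of `n` qubit states. -/
noncomputable def productVector (v : Fin n → Qubit) : Space n :=
  WithLp.toLp 2 fun b => ∏ j, v j (b j)

@[simp] theorem productVector_apply (v : Fin n → Qubit) (b : Fin n → ZMod 2) :
    productVector v b = ∏ j, v j (b j) := rfl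

theorem productVector_single (c : Fin n → ZMod 2) :
    productVector (fun j => EuclideanSpace.single (c j) 1) = EuclideanSpace.single c 1 := by
  ext b
  simp only [productVector_apply, PiLp.single_apply, Finset.prod_ite_zero,
    Finset.prod_const_one, Finset.mem_univ, true_imp_iff, funext_iff]

/-- The tensor product structure on the state space of `n` qubits. -/
noncomputable def tensor (n : ℕ) : HilbertTensor (fun _ : Fin n => Qubit) (Space n) where
  tmul :=
    { toFun := productVector
      map_update_add' := fun {d} v i x y => by
        ext b
        -- Multilinearity is required for an arbitrary `DecidableEq` instance on the index type,
        -- which is identified with the standard one.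
        obtain rfl : d = instDecidableEqFin n := Subsingleton.elim _ _
        simp only [productVector_apply, PiLp.add_apply]
        rw [← Finset.mul_prod_erase _ _ (Finset.mem_univ i),
          ← Finset.mul_prod_erase _ _ (Finset.mem_univ i),
          ← Finset.mul_prod_erase _ _ (Finset.mem_univ i)]
        simp only [Function.update_self, PiLp.add_apply, add_mul]
        congr 2 <;> exact Finset.prod_congr rfl fun j hj => by
          simp [Function.update_of_ne (Finset.ne_of_mem_erase hj)]
      map_update_smul' := fun {d} v i c x => by
        ext b
        obtain rfl : d = instDecidableEqFin n := Subsingleton.elim _ _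
        simp only [productVector_apply, PiLp.smul_apply]
        rw [← Finset.mul_prod_erase _ _ (Finset.mem_univ i),
          ← Finset.mul_prod_erase _ _ (Finset.mem_univ i)]
        simp only [Function.update_self, PiLp.smul_apply, smul_eq_mul, mul_assoc]
        congr 2
        exact Finset.prod_congr rfl fun j hj => by
          simp [Function.update_of_ne (Finset.ne_of_mem_erase hj)] }
  inner_tmul v w := by
    change inner ℂ (productVector v) (productVector w) = _
    simp only [PiLp.inner_apply, productVector_apply]
    rw [Finset.prod_univ_sum, Fintype.piFinset_univ]
    simp [Finset.prod_mul_distrib]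
  dense_span := by
    refine Dense.mono (s₁ := Set.univ) ?_ dense_univ
    intro x _
    change x ∈ Submodule.span ℂ (Set.range productVector)
    have hx : x = ∑ c, x c • EuclideanSpace.single c (1 : ℂ) := by
      ext b
      simp [WithLp.ofLp_sum, Pi.single_apply]
    rw [hx]
    refine Submodule.sum_mem _ fun c _ => Submodule.smul_mem _ _ (Submodule.subset_span ?_)
    exact ⟨_, productVector_single c⟩

theorem tensor_tmul (v : Fin n → Qubit) : (tensor n).tmul v = productVector v := rfl

/-- The eigenvector, for outcome `m`, of the qubit observable `cos θ X + sin θ Y`. -/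
noncomputable def equator (θ : ℝ) (m : ZMod 2) : Qubit :=
  WithLp.toLp 2 fun b => if b = 0 then ((√2)⁻¹ : ℝ) else
    ((√2)⁻¹ : ℝ) * ((sgn m : ℝ) * Complex.exp (θ * Complex.I))

theorem equator_zero (θ : ℝ) (m : ZMod 2) : equator θ m 0 = ((√2)⁻¹ : ℝ) := rfl

theorem equator_one (θ : ℝ) (m : ZMod 2) : equator θ m 1 =
    ((√2)⁻¹ : ℝ) * ((sgn m : ℝ) * Complex.exp (θ * Complex.I)) := rfl

theorem inv_sqrt_two_mul_self : (((√2)⁻¹ : ℝ) : ℂ) * ((√2)⁻¹ : ℝ) = 2⁻¹ := by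
  rw [← Complex.ofReal_mul, ← mul_inv, Real.mul_self_sqrt zero_le_two]
  simp

/-- The projection onto `equator θ m`. -/
noncomputable def projector (θ : ℝ) (m : ZMod 2) : Qubit →L[ℂ] Qubit :=
  InnerProductSpace.rankOne ℂ (equator θ m) (equator θ m)

theorem sum_projector (θ : ℝ) : ∑ m, projector θ m = 1 := by
  have hs := inv_sqrt_two_mul_self
  have he : Complex.exp (θ * Complex.I) * Complex.exp (-(θ * Complex.I)) = 1 := by
    rw [← Complex.exp_add, add_neg_cancel, Complex.exp_zero]
  have hc : (starRingEnd ℂ) (Complex.exp (θ * Complex.I)) = Complex.exp (-(θ * Complex.I)) := by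
    rw [← Complex.exp_conj]; simp
  rw [sum_zmod_two]
  ext v b
  simp only [projector, add_apply, InnerProductSpace.rankOne_apply, PiLp.add_apply,
    PiLp.smul_apply, PiLp.inner_apply, sum_zmod_two, smul_eq_mul, RCLike.inner_apply,
    one_apply_eq_self]
  rcases zmod_two_cases b with rfl | rfl <;>
    simp only [equator_zero, equator_one, map_mul, Complex.conj_ofReal, hc, sgn_zero, sgn_one,
      Complex.ofReal_one, Complex.ofReal_neg, map_one, map_neg]
  · linear_combination 2 * v 0 * hs
  · linear_combination 2 * v 1 * hs * Complex.exp (θ * Complex.I) *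
      Complex.exp (-(θ * Complex.I)) + v 1 * he

theorem tensorOp_projector (θ : Fin n → ℝ) (m : Fin n → ZMod 2) :
    (tensor n).tensorOp (fun j => projector (θ j) (m j)) =
      InnerProductSpace.rankOne ℂ (productVector fun j => equator (θ j) (m j))
        (productVector fun j => equator (θ j) (m j)) := by
  refine (tensor n).ext_tmul fun v => ?_
  rw [HilbertTensor.tensorOp_tmul]
  simp only [projector, InnerProductSpace.rankOne_apply]
  rw [(tensor n).tmul.map_smul_univ, tensor_tmul, ← tensor_tmul, (tensor n).inner_tmul]

/-! ### Measurement statistics of products of GHZ states. -/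

section GHZ

variable {r : ℕ}

/-- The product of GHZ states, one for each fibre of `γ`. -/
noncomputable def ghz (γ : Fin n → Fin r) : Space n :=
  (((√2)⁻¹ : ℝ) : ℂ) ^ r • ∑ c : Fin r → ZMod 2, EuclideanSpace.single (c ∘ γ) 1

theorem norm_ghz {γ : Fin n → Fin r} (hγ : Function.Surjective γ) : ‖ghz γ‖ = 1 := by
  have h : inner ℂ (ghz γ) (ghz γ) = (1 : ℂ) := by
    -- Surjectivity of `γ` keeps the `2 ^ r` basis vectors distinct, which makes the normalisation
    -- correct.
    have hinj : ∀ c d : Fin r → ZMod 2, c ∘ γ = d ∘ γ ↔ c = d := fun c d =>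
      hγ.injective_comp_right.eq_iff
    simp only [ghz, inner_smul_left, inner_smul_right, sum_inner, inner_sum, map_pow,
      Complex.conj_ofReal, EuclideanSpace.inner_single_left, PiLp.single_apply, hinj, map_one,
      one_mul, mul_one, Finset.sum_ite_eq', Finset.mem_univ, if_true, Finset.sum_const,
      Finset.card_univ, Fintype.card_fun, ZMod.card, Fintype.card_fin, nsmul_eq_mul,
      Nat.cast_pow, Nat.cast_ofNat]
    rw [mul_left_comm, ← mul_pow, ← mul_pow, inv_sqrt_two_mul_self]
    simp
  rw [inner_self_eq_norm_sq_to_K] at h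
  have h1 : ‖ghz γ‖ ^ 2 = 1 := Complex.ofReal_injective (by simpa using h)
  exact (pow_eq_one_iff_of_nonneg (norm_nonneg _) two_ne_zero).1 h1

theorem inner_productVector_ghz (v : Fin n → Qubit) (γ : Fin n → Fin r) :
    inner ℂ (productVector v) (ghz γ) = (((√2)⁻¹ : ℝ) : ℂ) ^ r *
      ∏ g, ∑ b, ∏ j with γ j = g, (starRingEnd ℂ) (v j b) := by
  rw [Finset.prod_univ_sum, Fintype.piFinset_univ, ghz, inner_smul_right, inner_sum]
  congr 1
  refine Finset.sum_congr rfl fun c _ => ?_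
  rw [EuclideanSpace.inner_single_right, one_mul, productVector_apply, map_prod]
  rw [← Finset.prod_fiberwise Finset.univ γ]
  refine Finset.prod_congr rfl fun g _ => Finset.prod_congr rfl fun j hj => ?_
  rw [Function.comp_apply, (Finset.mem_filter.1 hj).2]

/-- The two branches of a GHZ state interfere as `1 + σ exp(i t)`, with `σ` the sign of the output
parity and `t` the total angle. The squared modulus of this is `2 (1 + σ cos t)`. -/
theorem normSq_sum_prod_equator (S : Finset (Fin n)) (θ : Fin n → ℝ) (m : Fin n → ZMod 2) :
    Complex.normSq (∑ b, ∏ j ∈ S, (starRingEnd ℂ) (equator (θ j) (m j) b)) =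
      (1 / 2) ^ S.card * (2 * (1 + sgn (∑ j ∈ S, m j) * Real.cos (∑ j ∈ S, θ j))) := by
  have h : ∑ b, ∏ j ∈ S, (starRingEnd ℂ) (equator (θ j) (m j) b) =
      (starRingEnd ℂ) ((((√2)⁻¹ ^ S.card : ℝ) : ℂ) *
        (1 + (sgn (∑ j ∈ S, m j) : ℝ) * Complex.exp ((∑ j ∈ S, θ j : ℝ) * Complex.I))) := by
    rw [sum_zmod_two, ← map_prod, ← map_prod, ← map_add]
    congr 1
    simp only [equator_zero, equator_one, Finset.prod_mul_distrib, Finset.prod_const]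
    rw [← Complex.exp_sum, ← Finset.sum_mul, sgn_sum]
    push_cast
    ring
  rw [h, Complex.normSq_conj, Complex.normSq_mul, Complex.normSq_ofReal, ← mul_pow, ← mul_inv,
    Real.mul_self_sqrt zero_le_two, one_div]
  congr 1
  rw [Complex.normSq_apply]
  have hs := sgn_mul_self (∑ j ∈ S, m j)
  have hc := Real.sin_sq_add_cos_sq (∑ j ∈ S, θ j)
  generalize sgn (∑ j ∈ S, m j) = σ at hs
  generalize ∑ j ∈ S, θ j = t at hc
  simp only [Complex.add_re, Complex.one_re, Complex.add_im, Complex.one_im,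
    Complex.re_ofReal_mul, Complex.im_ofReal_mul, Complex.exp_ofReal_mul_I_re,
    Complex.exp_ofReal_mul_I_im]
  linear_combination hs * (Real.sin t ^ 2 + Real.cos t ^ 2) + hc

/-- Equatorial qubit measurements with angles `θ j s` on a product of GHZ states. -/
noncomputable def ghzExperiment (γ : Fin n → Fin r) (hγ : Function.Surjective γ)
    (θ : Fin n → ZMod 2 → ℝ) : QuantumExperiment n where
  E _ := Qubit
  H := Space n
  tensor := tensor n
  w l := if l = 0 then 1 else 0
  w_nonneg l := by split_ifs <;> simp
  w_sum := hasSum_ite_eq 0 1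
  ψ _ := ghz γ
  norm_ψ _ := norm_ghz hγ
  povm j s m := projector (θ j s) m
  povm_pos _ _ _ := InnerProductSpace.isPositive_rankOne_self _
  povm_sum _ _ := sum_projector _

theorem isPure_ghzExperiment (γ : Fin n → Fin r) (hγ : Function.Surjective γ)
    (θ : Fin n → ZMod 2 → ℝ) : (ghzExperiment γ hγ θ).IsPure := ⟨0, by simp [ghzExperiment]⟩

/-- The amplitude factors over the GHZ states. The normalisation `2⁻¹ ^ r` of the state cancels the
factor 2 that each interference term contributes. -/
theorem prob_ghzExperiment (γ : Fin n → Fin r) (hγ : Function.Surjective γ)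
    (θ : Fin n → ZMod 2 → ℝ) (s m : Fin n → ZMod 2) :
    (ghzExperiment γ hγ θ).prob s m = (1 / 2) ^ n *
      ∏ g, (1 + sgn (∑ j with γ j = g, m j) * Real.cos (∑ j with γ j = g, θ j (s j))) := by
  have h1 : (ghzExperiment γ hγ θ).prob s m = Complex.normSq
      (inner ℂ (productVector fun j => equator (θ j (s j)) (m j)) (ghz γ)) := by
    change ∑' l : ℕ, (if l = 0 then (1 : ℝ) else 0) * (inner ℂ (ghz γ)
      ((tensor n).tensorOp (fun j => projector (θ j (s j)) (m j)) (ghz γ))).re = _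
    rw [tsum_eq_single 0 fun l hl => by simp [hl], if_pos rfl, one_mul, tensorOp_projector,
      InnerProductSpace.rankOne_apply, inner_smul_right, ← inner_conj_symm (ghz γ),
      Complex.mul_conj, Complex.ofReal_re]
  have hcard : ∑ g, (Finset.univ.filter fun j => γ j = g).card = n := by
    rw [← Finset.card_eq_sum_card_fiberwise fun x _ => Finset.mem_univ _]
    simp
  rw [h1, inner_productVector_ghz, Complex.normSq_mul, map_pow, map_prod]
  simp only [normSq_sum_prod_equator]
  rw [Finset.prod_mul_distrib, Finset.prod_mul_distrib, Finset.prod_pow_eq_pow_sum, hcard,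
    Complex.normSq_ofReal, ← mul_inv, Real.mul_self_sqrt zero_le_two, Finset.prod_const,
    Finset.card_univ, Fintype.card_fin]
  have h2 : ((2 : ℝ)⁻¹) ^ r * 2 ^ r = 1 := by rw [← mul_pow]; norm_num
  linear_combination ((1 / 2) ^ n * ∏ g, (1 + sgn (∑ j with γ j = g, m j) *
    Real.cos (∑ j with γ j = g, θ j (s j)))) * h2

theorem prob_ghzExperiment_nonneg (γ : Fin n → Fin r) (hγ : Function.Surjective γ)
    (θ : Fin n → ZMod 2 → ℝ) (s m : Fin n → ZMod 2) : 0 ≤ (ghzExperiment γ hγ θ).prob s m := by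
  rw [prob_ghzExperiment]
  refine mul_nonneg (by positivity) (Finset.prod_nonneg fun g _ => ?_)
  have h1 := Real.neg_one_le_cos (∑ j with γ j = g, θ j (s j))
  have h2 := Real.cos_le_one (∑ j with γ j = g, θ j (s j))
  rcases zmod_two_cases (∑ j with γ j = g, m j) with h | h <;> rw [h] <;> simp <;> linarith

/-- If the angles at each GHZ state sum to a multiple `t g` of `π`, exactly the outputs
whose parities at the GHZ states are `t g` occur. -/
theorem prob_ghzExperiment_ne_zero_iff (γ : Fin n → Fin r) (hγ : Function.Surjective γ)
    (θ : Fin n → ZMod 2 → ℝ) (s m : Fin n → ZMod 2) (t : Fin r → ZMod 2)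
    (ht : ∀ g, Real.cos (∑ j with γ j = g, θ j (s j)) = sgn (t g)) :
    (ghzExperiment γ hγ θ).prob s m ≠ 0 ↔ ∀ g, ∑ j with γ j = g, m j = t g := by
  rw [prob_ghzExperiment]
  simp only [ht, mul_ne_zero_iff, Finset.prod_ne_zero_iff, Finset.mem_univ, true_imp_iff]
  refine (and_iff_right (by positivity)).trans (forall_congr' fun g => ?_)
  rw [← sgn_add]
  generalize ∑ j with γ j = g, m j = p
  have h2 : (1 : ZMod 2) + 1 = 0 := by decide
  rcases zmod_two_cases p with rfl | rfl <;> rcases zmod_two_cases (t g) with h | h <;>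
    simp [h, h2]

end GHZ

end Qubits

/-! ### Post-selected correlators and certain parities. -/

variable {n k : ℕ}

/-- An experiment attains the vertex of `f` if every accepted datum of nonzero probability has
output parity `f x`, and there is one. -/
theorem isCorrelator_vertex {Q : QuantumExperiment n} {g : PostSelection n k}
    {f : (Fin k → ZMod 2) → ZMod 2} (hQ : ∀ s m, 0 ≤ Q.prob s m)
    (hpos : ∀ x, ∃ s m, g.Accepts x s m ∧ Q.prob s m ≠ 0)
    (hpar : ∀ x s m, g.Accepts x s m → Q.prob s m ≠ 0 → ∑ j, m j = f x) :
    IsCorrelator Q g (vertex f) := by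
  classical
  intro x
  have h0 : 0 < acceptedProb Q g x fun _ _ => True := by
    obtain ⟨s, m, ha, hp⟩ := hpos x
    have hnn : ∀ s m, 0 ≤ (1 / 2 : ℝ) ^ n * Q.prob s m := fun s m =>
      mul_nonneg (by positivity) (hQ s m)
    refine Finset.sum_pos' (fun s _ => Finset.sum_nonneg fun m _ => ?_)
      ⟨s, Finset.mem_univ _, Finset.sum_pos' (fun m _ => ?_) ⟨m, Finset.mem_univ _, ?_⟩⟩
    · split_ifs
      exacts [hnn s m, le_rfl]
    · split_ifs
      exacts [hnn s m, le_rfl]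
    · rw [if_pos ⟨ha, trivial⟩]
      exact mul_pos (by positivity) (lt_of_le_of_ne (hQ s m) hp.symm)
  refine ⟨h0, ?_⟩
  by_cases hfx : f x = 1
  · rw [vertex, if_pos hfx, eq_comm, div_eq_one_iff_eq h0.ne']
    refine Finset.sum_congr rfl fun s _ => Finset.sum_congr rfl fun m _ => ?_
    by_cases ha : g.Accepts x s m
    · by_cases hp : Q.prob s m = 0
      · simp [hp]
      · rw [if_pos ⟨ha, (hpar x s m ha hp).trans hfx⟩, if_pos ⟨ha, trivial⟩]
    · rw [if_neg fun h => ha h.1, if_neg fun h => ha h.1]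
  · rw [vertex, if_neg hfx, eq_comm, div_eq_zero_iff]
    left
    refine Finset.sum_eq_zero fun s _ => Finset.sum_eq_zero fun m _ => ?_
    by_cases hp : Q.prob s m = 0
    · simp [hp]
    · exact if_neg fun h => hfx ((hpar x s m h.1 hp).symm.trans h.2)

/-- Acceptance under input post-selection fixes `s` and leaves `m` free, so it costs only the factor
`(1 / 2) ^ n` for the random inputs. -/
theorem acceptedProb_of_input (Q : QuantumExperiment n) {g : PostSelection n k}
    {h : Fin n → (Fin k → ZMod 2) → ZMod 2} (hg : ∀ j x m, g j x m = h j x)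
    (x : Fin k → ZMod 2) (C : (Fin n → ZMod 2) → Prop) [DecidablePred C] :
    acceptedProb Q g x (fun _ m => C m) =
      (1 / 2) ^ n * ∑ m with C m, Q.prob (fun j => h j x) m := by
  classical
  have hacc : ∀ s m, g.Accepts x s m ↔ s = fun j => h j x := fun s m => by
    simp only [PostSelection.Accepts, hg, funext_iff]
  unfold acceptedProb
  rw [Finset.sum_eq_single (fun j => h j x), Finset.mul_sum, Finset.sum_filter]
  · refine Finset.sum_congr rfl fun m _ => ?_
    by_cases hC : C m
    · rw [if_pos ⟨(hacc _ _).2 rfl, hC⟩, if_pos hC]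
    · rw [if_neg fun h => hC h.2, if_neg hC]
  · exact fun s _ hs => Finset.sum_eq_zero fun m _ => if_neg fun h => hs ((hacc s m).1 h.1)
  · exact fun h => absurd (Finset.mem_univ _) h

/-- Under LI, attaining the vertex of `f` means producing the parity `f x` with certainty from
affine inputs. -/
theorem exists_of_vertex_mem_liCorrelators {f : (Fin k → ZMod 2) → ZMod 2}
    (hf : vertex f ∈ liCorrelators n k) :
    ∃ (Q : QuantumExperiment n) (h : Fin n → (Fin k → ZMod 2) → ZMod 2),
      (∀ j, IsLinearBoolean (h j)) ∧
        ∀ x, ∑ m with ∑ j, m j = f x, Q.prob (fun j => h j x) m = 1 := by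
  obtain ⟨Q, g, ⟨h, hh, hg⟩, hQ⟩ := hf
  refine ⟨Q, h, hh, fun x => ?_⟩
  have h1 := (hQ x).2
  have hpow : ((1 : ℝ) / 2) ^ n ≠ 0 := by positivity
  rw [acceptedProb_of_input Q hg x (fun m => ∑ j, m j = 1),
    acceptedProb_of_input Q hg x (fun _ => True), mul_div_mul_left _ _ hpow,
    Finset.filter_true, Q.sum_prob, div_one, vertex] at h1
  rcases zmod_two_cases (f x) with hfx | hfx
  · rw [hfx, if_neg zero_ne_one] at h1
    have h2 := Q.sum_prob fun j => h j x
    rw [← Finset.sum_filter_add_sum_filter_not _ (fun m => ∑ j, m j = 1), ← h1, zero_add] at h2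
    rw [hfx, ← h2]
    refine Finset.sum_congr (Finset.filter_congr fun m _ => ?_) fun _ _ => rfl
    generalize ∑ j, m j = c
    revert c; decide
  · rw [hfx, if_pos rfl] at h1
    rw [hfx, ← h1]

theorem liCorrelators_subset_loiCorrelators (n k : ℕ) :
    liCorrelators n k ⊆ loiCorrelators n k := by
  rintro p ⟨Q, g, ⟨h, hh, hg⟩, hQ⟩
  refine ⟨Q, g, fun j => ?_, hQ⟩
  obtain ⟨a, b, hab⟩ := hh j
  exact ⟨Sum.elim a 0, b, fun y => by simp [hg, hab, Fintype.sum_sum_type]⟩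

/-! ### Computing the product of bits with one large GHZ state. -/

section GHZComputation

theorem val_eq_sgn (b : ZMod 2) : (b.val : ℝ) = (1 - sgn b) / 2 := by
  rcases zmod_two_cases b with rfl | rfl
  · simp
  · have : (1 : ZMod 2).val = 1 := rfl
    rw [this]; norm_num

theorem cos_val_mul_pi (b : ZMod 2) : Real.cos (b.val * Real.pi) = sgn b := by
  rcases zmod_two_cases b with rfl | rfl
  · simp
  · have : (1 : ZMod 2).val = 1 := rfl
    simp [this]

/-- The expansion of a product of bits into parities. -/
theorem sum_sgn_mul_val (hk : 1 ≤ k) (x : Fin k → ZMod 2) :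
    ∑ a : Fin k → ZMod 2, -sgn (∑ i, a i) * ((a ⬝ᵥ x).val : ℝ) =
      2 ^ (k - 1) * ((prodFn k x).val : ℝ) := by
  have hprod : ∀ F : Fin k → ZMod 2 → ℝ, ∑ a : Fin k → ZMod 2, ∏ i, F i (a i) =
      ∏ i, (F i 0 + F i 1) := fun F => by
    simp only [← sum_zmod_two]
    rw [Finset.prod_univ_sum, Fintype.piFinset_univ]
  -- The sum is `∏ (1 - 1)`, which vanishes because `k ≥ 1`.
  have h1 : ∑ a : Fin k → ZMod 2, sgn (∑ i, a i) = 0 := by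
    simp only [sgn_sum]
    rw [hprod fun _ b => sgn b]
    exact Finset.prod_eq_zero (Finset.mem_univ ⟨0, hk⟩) (by simp)
  -- The sum is `∏ (1 - sgn (x i))`: every factor is 2 if all bits are 1, and some factor is 0
  -- otherwise.
  have h2 : ∑ a : Fin k → ZMod 2, sgn (∑ i, a i) * sgn (a ⬝ᵥ x) =
      2 ^ k * ((prodFn k x).val : ℝ) := by
    simp only [dotProduct, sgn_sum, ← Finset.prod_mul_distrib]
    rw [hprod fun i b => sgn b * sgn (b * x i)]
    simp only [sgn_zero, sgn_one, zero_mul, one_mul]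
    by_cases hx : ∀ i, x i = 1
    · have : (1 : ZMod 2).val = 1 := rfl
      simp only [prodFn, hx, Finset.prod_const_one, this, sgn_one]
      norm_num
    · push Not at hx
      obtain ⟨i, hi⟩ := hx
      have hi := (zmod_two_cases _).resolve_right hi
      rw [prodFn, Finset.prod_eq_zero (Finset.mem_univ i) hi,
        Finset.prod_eq_zero (Finset.mem_univ i) (by simp [hi])]
      simp
  have h3 : (2 : ℝ) ^ k = 2 * 2 ^ (k - 1) := by
    rw [← pow_succ']; congr 1; omega
  simp only [val_eq_sgn (_ ⬝ᵥ x)]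
  have h4 : ∀ a : Fin k → ZMod 2, -sgn (∑ i, a i) * ((1 - sgn (a ⬝ᵥ x)) / 2) =
      (sgn (∑ i, a i) * sgn (a ⬝ᵥ x) - sgn (∑ i, a i)) / 2 := fun a => by ring
  simp only [h4]
  rw [← Finset.sum_div, Finset.sum_sub_distrib, h1, h2, h3]
  ring

/-- A GHZ state of `2 ^ k - 1` qubits computes the product of `k` bits from affine inputs. -/
theorem exists_ghz_computing_prodFn (hk : 1 ≤ k) :
    ∃ (Q : QuantumExperiment (2 ^ k - 1)) (h : Fin (2 ^ k - 1) → (Fin k → ZMod 2) → ZMod 2),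
      Q.IsPure ∧ (∀ j, IsLinearBoolean (h j)) ∧ (∀ s m, 0 ≤ Q.prob s m) ∧
        ∀ x m, Q.prob (fun j => h j x) m ≠ 0 → ∑ j, m j = prodFn k x := by
  have hcard : Fintype.card {a : Fin k → ZMod 2 // a ≠ 0} = 2 ^ k - 1 := by
    rw [Fintype.card_subtype_compl]
    simp [ZMod.card]
  let e : Fin (2 ^ k - 1) ≃ {a : Fin k → ZMod 2 // a ≠ 0} :=
    (Fintype.equivFinOfCardEq hcard).symm
  have hpos : 0 < 2 ^ k - 1 := Nat.sub_pos_of_lt (Nat.one_lt_two_pow (by omega))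
  have hγ : Function.Surjective fun _ : Fin (2 ^ k - 1) => (0 : Fin 1) :=
    fun g => ⟨⟨0, hpos⟩, Subsingleton.elim _ _⟩
  -- The coefficients of the parity expansion, scaled so that the total angle is `π` times the
  -- product of the bits. The vector `a = 0` contributes nothing there, so `2 ^ k - 1` qubits
  -- suffice.
  let φ : (Fin k → ZMod 2) → ℝ := fun a => -sgn (∑ i, a i) * (Real.pi / 2 ^ (k - 1))
  let θ : Fin (2 ^ k - 1) → ZMod 2 → ℝ := fun j s => s.val * φ (e j)
  refine ⟨Qubits.ghzExperiment _ hγ θ, fun j x => (e j : Fin k → ZMod 2) ⬝ᵥ x,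
    Qubits.isPure_ghzExperiment _ _ _, fun j => ⟨e j, 0, fun s => by simp [dotProduct]⟩,
    Qubits.prob_ghzExperiment_nonneg _ _ _, fun x m hm => ?_⟩
  have hangle : ∑ j, θ j ((e j : Fin k → ZMod 2) ⬝ᵥ x) = (prodFn k x).val * Real.pi := by
    have h1 : ∑ j, θ j ((e j : Fin k → ZMod 2) ⬝ᵥ x) =
        ∑ a : {a : Fin k → ZMod 2 // a ≠ 0}, (((a : Fin k → ZMod 2) ⬝ᵥ x).val : ℝ) * φ a :=
      Equiv.sum_comp e fun a : {a : Fin k → ZMod 2 // a ≠ 0} =>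
        (((a : Fin k → ZMod 2) ⬝ᵥ x).val : ℝ) * φ a
    rw [h1, ← Finset.sum_subtype (Finset.univ.filter (· ≠ 0)) (by simp)
      fun a : Fin k → ZMod 2 => ((a ⬝ᵥ x).val : ℝ) * φ a,
      Finset.sum_filter_of_ne fun a _ h => by rintro rfl; simp at h]
    have h2 : ∀ a : Fin k → ZMod 2, ((a ⬝ᵥ x).val : ℝ) * φ a =
        -sgn (∑ i, a i) * ((a ⬝ᵥ x).val : ℝ) * (Real.pi / 2 ^ (k - 1)) := fun a => by
      simp only [φ]; ring
    simp only [h2]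
    rw [← Finset.sum_mul, sum_sgn_mul_val hk x]
    field_simp
  have := (Qubits.prob_ghzExperiment_ne_zero_iff _ hγ θ _ m (fun _ => prodFn k x) (fun g => by
    rw [Finset.filter_true_of_mem fun j _ => Subsingleton.elim _ _, hangle,
      cos_val_mul_pi])).1 hm 0
  simpa using this

end GHZComputation

/-! ### The least number of parties under LI and in nMBQC. -/

theorem vertex_prodFn_mem_liCorrelators (hk : 1 ≤ k) :
    vertex (prodFn k) ∈ liCorrelators (2 ^ k - 1) k := by
  obtain ⟨Q, h, -, hh, hQ, hpar⟩ := exists_ghz_computing_prodFn hk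
  refine ⟨Q, fun j x _ => h j x, ⟨h, hh, fun _ _ _ => rfl⟩,
    isCorrelator_vertex hQ (fun x => ?_) fun x s m hs hp => ?_⟩
  · have h1 : ∑ m, Q.prob (fun j => h j x) m ≠ 0 := by
      rw [Q.sum_prob]; exact one_ne_zero
    obtain ⟨m, -, hm⟩ := Finset.exists_ne_zero_of_sum_ne_zero h1
    exact ⟨_, m, fun _ => rfl, hm⟩
  · obtain rfl : s = fun j => h j x := funext hs
    exact hpar x m hp

theorem performedByNMBQC_prodFn (hk : 1 ≤ k) : PerformedByNMBQC (2 ^ k - 1) (prodFn k) := by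
  obtain ⟨Q, h, hpure, hh, -, hpar⟩ := exists_ghz_computing_prodFn hk
  refine ⟨Q, h, hpure, hh, fun x => ?_⟩
  rw [← Q.sum_prob fun j => h j x, Finset.sum_filter]
  refine Finset.sum_congr rfl fun m _ => ?_
  split_ifs with hm
  · rfl
  · by_contra hne
    exact hm (hpar x m (Ne.symm hne))

theorem isLeast_liCorrelators (hk : 1 ≤ k) :
    IsLeast {n : ℕ | vertex (prodFn k) ∈ liCorrelators n k} (2 ^ k - 1) := by
  refine ⟨vertex_prodFn_mem_liCorrelators hk, fun n hn => ?_⟩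
  obtain ⟨Q, h, hh, hf⟩ := exists_of_vertex_mem_liCorrelators hn
  exact le_of_parity_eq_prodFn Q h hh hf

theorem isLeast_performedByNMBQC (hk : 1 ≤ k) :
    IsLeast {n : ℕ | PerformedByNMBQC n (prodFn k)} (2 ^ k - 1) := by
  refine ⟨performedByNMBQC_prodFn hk, fun n hn => ?_⟩
  obtain ⟨Q, h, -, hh, hf⟩ := hn
  exact le_of_parity_eq_prodFn Q h hh hf

/-! ### Chains of GHZ states with inputs depending on earlier outputs -/

namespace Chain

variable {r : ℕ}

/-- The `t`-th site of the `i`-th GHZ state. -/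
def site (t : Fin 3) (i : Fin r) : Fin (3 * r) := finProdFinEquiv (t, i)

/-- The position of a site in its GHZ state. -/
def role (j : Fin (3 * r)) : Fin 3 := (finProdFinEquiv.symm j).1

/-- The GHZ state to which a site belongs. -/
def block (j : Fin (3 * r)) : Fin r := (finProdFinEquiv.symm j).2

@[simp] theorem role_site (t : Fin 3) (i : Fin r) : role (site t i) = t := by
  simp [role, site]

@[simp] theorem block_site (t : Fin 3) (i : Fin r) : block (site t i) = i := by
  simp [block, site]

theorem block_surjective : Function.Surjective (block : Fin (3 * r) → Fin r) :=
  fun i => ⟨site 0 i, block_site 0 i⟩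

theorem sum_block {M : Type*} [AddCommMonoid M] (F : Fin (3 * r) → M) (i : Fin r) :
    ∑ j with block j = i, F j = F (site 0 i) + F (site 1 i) + F (site 2 i) := by
  have h : Finset.univ.filter (fun j => block j = i) =
      Finset.univ.image fun t => site t i := by
    ext j
    simp only [Finset.mem_filter, Finset.mem_univ, true_and, Finset.mem_image]
    constructor
    · rintro rfl
      exact ⟨role j, finProdFinEquiv.apply_symm_apply j⟩
    · rintro ⟨t, rfl⟩
      exact block_site t i
  rw [h, Finset.sum_image fun t _ t' _ htt => by simpa using congrArg role htt,
    Fin.sum_univ_three]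

/-- The rate at which the measurement angle at a site increases with the input. -/
noncomputable def slope : Fin 3 → ℝ := ![3 * (Real.pi / 2), Real.pi / 2, -(Real.pi / 2)]

/-- The experiment on `r` three-qubit GHZ states. -/
noncomputable def experiment (r : ℕ) : QuantumExperiment (3 * r) :=
  Qubits.ghzExperiment block block_surjective fun j s => s.val * slope (role j)

/-- On inputs `u`, `v`, `u + v` the angles at a GHZ state sum to `u v + u` in units of `π`. -/
theorem cos_angle (u v : ZMod 2) :
    Real.cos (u.val * (3 * (Real.pi / 2)) + v.val * (Real.pi / 2) +
      (u + v).val * -(Real.pi / 2)) = sgn (u * v + u) := by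
  -- The bit `u + v` has integer value `u + v - 2 u v`, so the angle `(3 u + v - (u + v - 2 u v)) π
  -- / 2` equals `(u + u v) π`.
  have h1 : (1 : ZMod 2).val = 1 := rfl
  have h2 : (1 : ZMod 2) + 1 = 0 := by decide
  rcases zmod_two_cases u with rfl | rfl <;> rcases zmod_two_cases v with rfl | rfl
  · simp
  · simp [h1]
  · simp only [h1, add_zero, mul_zero, zero_add, ZMod.val_zero, sgn_one]
    rw [← Real.cos_pi]
    congr 1
    push_cast
    ring
  · simp only [h1, h2, mul_one, ZMod.val_zero, sgn_zero]
    rw [← Real.cos_two_pi]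
    congr 1
    push_cast
    ring

/-- The coefficients of the two input bits of a GHZ state in the inputs of its sites. -/
def coeffLeft : Fin 3 → ZMod 2 := ![1, 0, 1]

/-- See `coeffLeft`. -/
def coeffRight : Fin 3 → ZMod 2 := ![0, 1, 1]

/-- The sum of the outputs at the first `i` GHZ states. -/
def partialParity (m : Fin (3 * r) → ZMod 2) (i : ℕ) : ZMod 2 :=
  ∑ j with (block j : ℕ) < i, m j

/-- The first input bit of the `i`-th GHZ state: the parity of all earlier outputs, or `x 0` at
the start of the chain. -/
def leftInput (x : Fin (r + 1) → ZMod 2) (m : Fin (3 * r) → ZMod 2) (i : Fin r) : ZMod 2 :=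
  (if (i : ℕ) = 0 then x 0 else 0) + partialParity m i

/-- The second input bit of the `i`-th GHZ state. -/
def rightInput (x : Fin (r + 1) → ZMod 2) (i : Fin r) : ZMod 2 :=
  x i.succ + if (i : ℕ) = 0 then 1 else 0

/-- The post-selection which feeds the outputs of the GHZ states forward along the chain. -/
def rule (r : ℕ) : PostSelection (3 * r) (r + 1) := fun j x m =>
  coeffLeft (role j) * ((if (block j : ℕ) = 0 then x 0 else 0) +
    ∑ i, if (block i.1 : ℕ) < block j then m i else 0) +
  coeffRight (role j) * rightInput x (block j)

/-- A site does not lie in a strictly earlier block than its own, so leaving out its own output does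
not change the partial parity. -/
theorem rule_apply (j : Fin (3 * r)) (x : Fin (r + 1) → ZMod 2) (m : Fin (3 * r) → ZMod 2) :
    rule r j x (fun i => m i) = coeffLeft (role j) * leftInput x m (block j) +
      coeffRight (role j) * rightInput x (block j) := by
  have h : (∑ i : {i : Fin (3 * r) // i ≠ j}, if (block i.1 : ℕ) < block j then m i else 0) =
      partialParity m (block j) := by
    rw [partialParity, Finset.sum_filter,
      ← Finset.sum_subtype (Finset.univ.filter (· ≠ j)) (by simp)
      fun i => if (block i : ℕ) < block j then m i else 0]
    refine Finset.sum_filter_of_ne fun i _ h => ?_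
    rintro rfl
    simp at h
  rw [rule, h, leftInput]

theorem isLOI_rule (r : ℕ) : (rule r).IsLOI := fun j => by
  refine ⟨Sum.elim (fun a => coeffLeft (role j) * (if (block j : ℕ) = 0 ∧ a = 0 then 1 else 0) +
      coeffRight (role j) * if a = (block j).succ then 1 else 0)
    fun i => coeffLeft (role j) * if (block i.1 : ℕ) < block j then 1 else 0,
    coeffRight (role j) * if (block j : ℕ) = 0 then 1 else 0, fun y => ?_⟩
  simp only [rule, rightInput, Fintype.sum_sum_type, Sum.elim_inl, Sum.elim_inr, add_mul,
    Finset.sum_add_distrib, mul_assoc, ← Finset.mul_sum, ite_mul, one_mul, zero_mul,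
    Finset.sum_ite_eq', Finset.mem_univ, if_true, ite_and]
  by_cases h : (block j : ℕ) = 0
  · simp only [h, if_true, Finset.sum_ite_eq', Finset.mem_univ]
    ring
  · simp only [h, if_false, Finset.sum_const_zero]
    ring

/-- The product of the bits `x 0, …, x i`. -/
def partialProd (x : Fin (r + 1) → ZMod 2) (i : ℕ) : ZMod 2 :=
  ∏ l : Fin (r + 1) with l.val ≤ i, x l

theorem partialProd_zero (x : Fin (r + 1) → ZMod 2) : partialProd x 0 = x 0 := by
  have : Finset.univ.filter (fun l : Fin (r + 1) => (l : ℕ) ≤ 0) = {0} := by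
    ext l
    simp only [Finset.mem_filter, Finset.mem_univ, true_and, Finset.mem_singleton, Fin.ext_iff,
      Fin.val_zero, Nat.le_zero]
  rw [partialProd, this, Finset.prod_singleton]

theorem partialProd_succ (x : Fin (r + 1) → ZMod 2) (i : Fin r) :
    partialProd x (i + 1) = partialProd x i * x i.succ := by
  have : Finset.univ.filter (fun l : Fin (r + 1) => (l : ℕ) ≤ i + 1) =
      insert i.succ (Finset.univ.filter fun l : Fin (r + 1) => (l : ℕ) ≤ i) := by
    ext l
    simp only [Finset.mem_filter, Finset.mem_univ, true_and, Finset.mem_insert, Fin.ext_iff,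
      Fin.val_succ]
    omega
  rw [partialProd, this, Finset.prod_insert (by simp), mul_comm, partialProd]

theorem partialProd_self (x : Fin (r + 1) → ZMod 2) : partialProd x r = prodFn (r + 1) x := by
  rw [partialProd, Finset.filter_true_of_mem fun l _ => Nat.lt_succ_iff.1 l.2, prodFn]

theorem partialParity_succ (m : Fin (3 * r) → ZMod 2) (i : Fin r) :
    partialParity m (i + 1) = partialParity m i + ∑ j with block j = i, m j := by
  have : Finset.univ.filter (fun j : Fin (3 * r) => (block j : ℕ) < i + 1) =
      Finset.univ.filter (fun j : Fin (3 * r) => (block j : ℕ) < i) ∪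
        Finset.univ.filter fun j => block j = i := by
    ext j
    simp only [Finset.mem_filter, Finset.mem_univ, true_and, Finset.mem_union, Fin.ext_iff]
    omega
  rw [partialParity, this, Finset.sum_union, partialParity]
  refine Finset.disjoint_filter.2 fun j _ h1 h2 => ?_
  rw [h2] at h1
  exact lt_irrefl _ h1

theorem partialParity_self (m : Fin (3 * r) → ZMod 2) : partialParity m r = ∑ j, m j := by
  rw [partialParity, Finset.filter_true_of_mem fun j _ => (block j).2]

/-- The parity of the outputs of the `i`-th GHZ state in the intended computation. -/
def blockParity (x : Fin (r + 1) → ZMod 2) (i : Fin r) : ZMod 2 :=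
  partialProd x i * rightInput x i + partialProd x i

theorem leftInput_eq {x : Fin (r + 1) → ZMod 2} {m : Fin (3 * r) → ZMod 2} {i : Fin r}
    (h : partialParity m i = partialProd x i + if (i : ℕ) = 0 then x 0 else 0) :
    leftInput x m i = partialProd x i := by
  rw [leftInput, h, add_left_comm, CharTwo.add_self_eq_zero, add_zero]

/-- A later block adds `P_i x_{i+1} + P_i`, which replaces the accumulated `P_i` by `P_{i+1}`, where
`P_i` is the product of `x_0, …, x_i`. At block 0 nothing is accumulated yet, so there is no `P_0`
to replace; the extra 1 in `rightInput` makes that block output `x_0 x_1`. The `if` records that the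
empty parity is 0 and not `x_0`. The hypothesis asks for the block parity only when the left input
is right, so it can be discharged for any accepted datum that occurs. -/
theorem partialParity_eq {x : Fin (r + 1) → ZMod 2} {m : Fin (3 * r) → ZMod 2}
    (h : ∀ i : Fin r, leftInput x m i = partialProd x i →
      ∑ j with block j = i, m j = blockParity x i) :
    ∀ i : ℕ, i ≤ r → partialParity m i = partialProd x i + if i = 0 then x 0 else 0 := by
  intro i hi
  induction i with
  | zero => simp [partialParity, partialProd_zero, CharTwo.add_self_eq_zero]
  | succ i ih =>
    have ih := ih (by omega)
    have h1 := partialParity_succ m ⟨i, hi⟩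
    have h2 := partialProd_succ x ⟨i, hi⟩
    have h3 := h ⟨i, hi⟩ (leftInput_eq ih)
    simp only at h1 h2
    rw [h1, h2, h3, ih, blockParity, rightInput, if_neg (Nat.succ_ne_zero i)]
    by_cases hi0 : i = 0
    · subst hi0
      simp only [partialProd_zero, if_true]
      linear_combination 2 * CharTwo.add_self_eq_zero (x 0)
    · simp only [hi0, if_false]
      linear_combination CharTwo.add_self_eq_zero (partialProd x i)

theorem prob_ne_zero_iff {x : Fin (r + 1) → ZMod 2} {s m : Fin (3 * r) → ZMod 2}
    (hs : (rule r).Accepts x s m) : (experiment r).prob s m ≠ 0 ↔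
      ∀ i, ∑ j with block j = i, m j = leftInput x m i * rightInput x i + leftInput x m i := by
  refine Qubits.prob_ghzExperiment_ne_zero_iff _ _ _ s m _ fun i => ?_
  rw [sum_block, hs, hs, hs, rule_apply, rule_apply, rule_apply]
  simp only [role_site, block_site, ← cos_angle]
  simp [coeffLeft, coeffRight, slope]

theorem isCorrelator_experiment (r : ℕ) (hr : 1 ≤ r) :
    IsCorrelator (experiment r) (rule r) (vertex (prodFn (r + 1))) := by
  refine isCorrelator_vertex (Qubits.prob_ghzExperiment_nonneg _ _ _) (fun x => ?_)
    fun x s m hs hp => ?_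
  · let m : Fin (3 * r) → ZMod 2 := fun j => if role j = 0 then blockParity x (block j) else 0
    have hm : ∀ i, ∑ j with block j = i, m j = blockParity x i := fun i => by
      rw [sum_block]; simp [m]
    have hacc : (rule r).Accepts x (fun j => rule r j x fun i => m i) m := fun j => rfl
    refine ⟨_, m, hacc, (prob_ne_zero_iff hacc).2 fun i => ?_⟩
    rw [hm, blockParity, leftInput_eq (partialParity_eq (fun i _ => hm i) i i.2.le)]
  · have h := (prob_ne_zero_iff hs).1 hp
    rw [← partialParity_self, partialParity_eq (x := x) (fun i hi => by rw [h, hi, blockParity])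
      -- The end of the chain is past the exceptional index 0 because `r ≥ 1`.
      r le_rfl, if_neg (by omega), add_zero, partialProd_self]

end Chain

theorem vertex_prodFn_mem_loiCorrelators {k : ℕ} (hk : 2 ≤ k) :
    vertex (prodFn k) ∈ loiCorrelators (3 * (k - 1)) k := by
  obtain ⟨r, rfl⟩ : ∃ r, k = r + 1 := ⟨k - 1, by omega⟩
  exact ⟨Chain.experiment r, Chain.rule r, Chain.isLOI_rule r,
    Chain.isCorrelator_experiment r (by omega)⟩

theorem three_mul_pred_lt {k : ℕ} (hk : 3 ≤ k) : 3 * (k - 1) < 2 ^ k - 1 := by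
  induction k, hk using Nat.le_induction with
  | base => norm_num
  | succ k hk ih => rw [pow_succ]; omega

end BellTest

theorem theorem4p2p3 :
    -- the vertex is attained under LOI with `3 (k - 1)` parties
    (∀ k : ℕ, 2 ≤ k →
      BellTest.vertex (BellTest.prodFn k) ∈ BellTest.loiCorrelators (3 * (k - 1)) k) ∧
    -- under LI, and in nMBQC, the least sufficient number of parties is `2 ^ k - 1`
    (∀ k : ℕ, 1 ≤ k →
      IsLeast {n : ℕ | BellTest.vertex (BellTest.prodFn k) ∈ BellTest.liCorrelators n k}
        (2 ^ k - 1) ∧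
      IsLeast {n : ℕ | BellTest.PerformedByNMBQC n (BellTest.prodFn k)} (2 ^ k - 1)) ∧
    -- the LOI set contains the LI set, strictly for `3 ≤ k` and `n = 3 (k - 1)`
    (∀ n k : ℕ, BellTest.liCorrelators n k ⊆ BellTest.loiCorrelators n k) ∧
    (∀ k : ℕ, 3 ≤ k →
      BellTest.liCorrelators (3 * (k - 1)) k ⊂ BellTest.loiCorrelators (3 * (k - 1)) k) := by
  refine ⟨fun k hk => BellTest.vertex_prodFn_mem_loiCorrelators hk,
    fun k hk => ⟨BellTest.isLeast_liCorrelators hk, BellTest.isLeast_performedByNMBQC hk⟩,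
    BellTest.liCorrelators_subset_loiCorrelators, fun k hk => ?_⟩
  refine (Set.ssubset_iff_of_subset (BellTest.liCorrelators_subset_loiCorrelators _ _)).2
    ⟨_, BellTest.vertex_prodFn_mem_loiCorrelators (by omega : 2 ≤ k), fun h => ?_⟩
  -- The vertex itself separates the two sets, since LI would need `2 ^ k - 1` parties.
  exact absurd ((BellTest.isLeast_liCorrelators (by omega : 1 ≤ k)).2 h)
    (BellTest.three_mul_pred_lt hk).not_ge
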